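/- Let $n\ge 1$ and let $\mathbf b=(b_1,\dots,b_n)$ be a vector of positive integers. A $\mathbf b$-parking function is a list $(\beta_1,\dots,\beta_n)$ of positive integers whose nondecreasing rearrangement $\beta'_1\le\dots\le\beta'_n$ satisfies $\beta'_i\le b_1+\dots+b_i$ for $1\le i\le n$. Let $\mathfrak X_n(\mathbf b)\subset\mathbb R^n$ be the convex hull of all $\mathbf b$-parking functions. For a polytope $P$, let $f_i(P)$ be the number of its $i$-dimensional faces, let $f(P;t)=\sum_{i=0}^{\dim P} f_i(P)\,t^i$, and let the $h$-polynomial of $P$ be $h(P;t)=f(P;t-1)$. For $k\ge 0$ let $A_k(z)=\sum_{\sigma\in\mathfrak S_k} z^{\mathrm{des}(\sigma)}$ be the Eulerian polynomial, where $\mathrm{des}(\sigma)$ is the number of indices $1\le i<k$ with $\sigma(i)>\sigma(i+1)$ (so $A_0=1$), and let $$\widetilde A_n(z)=1+z\sum_{k=1}^{n}\binom nk A_k(z)$$ be the binomial Eulerian polynomial. Then $$h(\mathfrak X_n(\mathbf b);z)=\begin{cases}\widetilde A_n(z)-n\,z\,A_{n-1}(z) & \text{if } b_1=1,\\ \widetilde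 A_n(z) & \text{if } b_1\ge 2.\end{cases}$$ -/

import Mathlib

open Polynomial

/-- `β` is a `b`-parking function: its entries are positive integers, and its nondecreasing
rearrangement `β'` (here `β ∘ Tuple.sort β`) satisfies `β'ᵢ ≤ b₁ + ⋯ + bᵢ` for every `i`. -/
def IsParkingFunction {n : ℕ} (b β : Fin n → ℕ) : Prop :=
  (∀ i, 0 < β i) ∧ ∀ i, β (Tuple.sort β i) ≤ ∑ j ∈ Finset.Iic i, b j

/-- The `b`-parking-function polytope: the convex hull in `ℝⁿ` of all `b`-parking functions. -/
def parkingPolytope {n : ℕ} (b : Fin n → ℕ) : Set (Fin n → ℝ) :=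
  convexHull ℝ {x | ∃ β : Fin n → ℕ, IsParkingFunction b β ∧ ∀ i, x i = (β i : ℝ)}

section Faces

variable {E : Type*} [AddCommGroup E] [Module ℝ E] [TopologicalSpace E]

/-- The dimension of a set: the dimension of its affine span. -/
noncomputable def affineDim (P : Set E) : ℕ :=
  Module.finrank ℝ (vectorSpan ℝ P)

/-- The `i`-dimensional (nonempty) faces of a polytope `P`; a nonempty face is the set of points
of `P` at which some linear functional attains its maximum over `P`. -/
def facesOfDim (P : Set E) (i : ℕ) : Set (Set E) :=
  {F | F.Nonempty ∧ IsExposed ℝ P F ∧ affineDim F = i}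

/-- The `f`-polynomial `∑_{i=0}^{dim P} fᵢ(P) tⁱ`, with `fᵢ(P)` the number of `i`-dimensional
faces of `P`. -/
noncomputable def fPolynomial (P : Set E) : ℤ[X] :=
  ∑ i ∈ Finset.range (affineDim P + 1), C ((facesOfDim P i).ncard : ℤ) * X ^ i

/-- The `h`-polynomial `h(P; t) = f(P; t - 1)`. -/
noncomputable def hPolynomial (P : Set E) : ℤ[X] :=
  (fPolynomial P).comp (X - 1)

end Faces

/-- The number of descents of a permutation, i.e. of positions `i` with `σ(i) > σ(i+1)`. -/
def descentCount {k : ℕ} (σ : Equiv.Perm (Fin k)) : ℕ :=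
  (Finset.univ.filter fun i : Fin k => ∃ h : i.1 + 1 < k, σ ⟨i.1 + 1, h⟩ < σ i).card

/-- The Eulerian polynomial `A_k(z) = ∑_{σ ∈ 𝔖_k} z^{des σ}` (so `A_0 = 1`). -/
noncomputable def eulerianPoly (k : ℕ) : ℤ[X] :=
  ∑ σ : Equiv.Perm (Fin k), X ^ descentCount σ

/-- The binomial Eulerian polynomial `1 + z ∑_{k=1}^n (n choose k) A_k(z)`. -/
noncomputable def binomialEulerianPoly (n : ℕ) : ℤ[X] :=
  1 + X * ∑ k ∈ Finset.Icc 1 n, C (n.choose k : ℤ) * eulerianPoly k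

/-! The face on which a functional `c` is maximal is cut out of the polytope by two families of
equations: `x i = 1` where `c i < 0`, and, for each positive value of `c`, the sum of `x` over the
corresponding superlevel set equals the largest possible sum `topSum` (`mem_maxFace_iff`). Hence the
face depends only on the set `N` of negative coordinates and on the ordered set partition of the
positive coordinates by the value of `c`. This is recorded as a pair `(f, N)`, with `f` packed and
vanishing on `N` (`toPair`, `maxFace_toPair`).

If no coordinate outside `N` is forced to be `1` by the order alone (`IsFree`), the face determines
the pair (`pair_ext`) and has dimension `n - #N - #blocks` (`affineDim_maxFace`). For `b₁ ≥ 2` every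
pair is free. For `b₁ = 1` the only obstruction is `N = ∅` with `f` having a unique minimum at some
`i`. There the coordinate `i` is `1` on the whole face, and moving `i` into `N` changes nothing
(`maxFace_update`), so such pairs are redundant and are discarded.

It remains to sum `t ^ dim` at `t = z - 1`. Ordered set partitions in which a block `B` weighs `t ^
(#B - 1)` obey a recursion on one block which the Eulerian polynomials at `1 + t` also obey
(`wordSum_rec`, `blockRecursive_packedSum`). The free choice of `N` among the zeros of `f`
contributes `(1 + t) ^ (n - #supp f)`, and `BlockRecursive.sum_pow_sdiff` turns the total into the
binomial Eulerian polynomial. The redundant pairs account for `n z A_{n-1}(z)`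
(`sum_signedPacked_degenerate`). -/

namespace ParkingPolytope

/-! ### Descents of words: a block recursion for the Eulerian polynomials. -/

section Eulerian

variable {R : Type*} [CommRing R]

theorem sum_powerset_by_max {α M : Type*} [LinearOrder α] [AddCommMonoid M] (S : Finset α)
    (φ : Finset α → M) :
    ∑ B ∈ S.powerset, φ B =
      φ ∅ + ∑ x ∈ S, ∑ B ∈ (S.filter (· < x)).powerset, φ (insert x B) := by
  induction S using Finset.induction_on_max with
  | empty => simp
  | insert m S hm ih =>
    have hmS : m ∉ S := fun h => lt_irrefl _ (hm m h)
    rw [Finset.sum_powerset_insert hmS, ih, Finset.sum_insert hmS, add_assoc]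
    congr 1
    rw [add_comm]
    congr 1
    · refine Finset.sum_congr ?_ fun _ _ => rfl
      congr 1
      ext y
      simp only [Finset.mem_filter, Finset.mem_insert]
      exact ⟨fun h => ⟨Or.inr h, hm y h⟩, fun h => h.1.resolve_left h.2.ne⟩
    · refine Finset.sum_congr rfl fun x hx => Finset.sum_congr ?_ fun _ _ => rfl
      congr 1
      ext y
      simp only [Finset.mem_filter, Finset.mem_insert]
      constructor
      · exact fun h => ⟨Or.inr h.1, h.2⟩
      · rintro ⟨rfl | h, h'⟩
        · exact absurd h' (hm x hx).not_gt
        · exact ⟨h, h'⟩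

/-- The number of descents of a word. -/
def descents {α : Type*} [LinearOrder α] {k : ℕ} (f : Fin k → α) : ℕ :=
  (Finset.univ.filter fun i : Fin k => ∃ h : i.1 + 1 < k, f ⟨i.1 + 1, h⟩ < f i).card

theorem descents_cons {α : Type*} [LinearOrder α] {k : ℕ} (a : α) (f : Fin (k + 1) → α) :
    descents (Fin.cons a f : Fin (k + 2) → α) = (if f 0 < a then 1 else 0) + descents f := by
  unfold descents
  rw [Fin.univ_succ, Finset.filter_cons]
  have h1 : ∀ i : Fin (k + 1), (∃ h : (Fin.succ i).1 + 1 < k + 2,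
      (Fin.cons a f : Fin (k + 2) → α) ⟨(Fin.succ i).1 + 1, h⟩
        < (Fin.cons a f : Fin (k + 2) → α) (Fin.succ i)) ↔
      ∃ h : i.1 + 1 < k + 1, f ⟨i.1 + 1, h⟩ < f i := by
    intro i
    constructor
    · rintro ⟨h, h'⟩
      exact ⟨by simpa using h, h'⟩
    · rintro ⟨h, h'⟩
      exact ⟨by simpa using h, h'⟩
  have h0 : (∃ h : (0 : Fin (k + 2)).1 + 1 < k + 2,
      (Fin.cons a f : Fin (k + 2) → α) ⟨(0 : Fin (k + 2)).1 + 1, h⟩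
        < (Fin.cons a f : Fin (k + 2) → α) 0) ↔ f 0 < a := by
    constructor
    · rintro ⟨h, h'⟩
      exact h'
    · intro h'
      exact ⟨by simp, h'⟩
  have h2 : (Finset.filter (fun i : Fin (k + 2) => ∃ h : i.1 + 1 < k + 2,
      (Fin.cons a f : Fin (k + 2) → α) ⟨i.1 + 1, h⟩
        < (Fin.cons a f : Fin (k + 2) → α) i)
        (Finset.map ⟨Fin.succ, Fin.succ_injective _⟩ Finset.univ)).card =
      (Finset.univ.filter fun i : Fin (k + 1) =>
        ∃ h : i.1 + 1 < k + 1, f ⟨i.1 + 1, h⟩ < f i).card := by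
    rw [Finset.filter_map, Finset.card_map]
    congr 1
    ext i
    simp only [Finset.mem_filter, Finset.mem_univ, true_and, Function.comp]
    exact h1 i
  split_ifs with h h' h'
  · rw [Finset.card_cons, h2, add_comm]
  · exact absurd (h0.1 h) h'
  · exact absurd (h0.2 h') h
  · rw [h2, zero_add]

variable {α : Type*} [LinearOrder α] [Fintype α]

/-- The words of length `k` without repetitions and with letters in `s`. -/
noncomputable def injWords (k : ℕ) (s : Finset α) : Finset (Fin k → α) :=
  open Classical in Finset.univ.filter fun f => Function.Injective f ∧ ∀ i, f i ∈ s

theorem mem_injWords {k : ℕ} {s : Finset α} {f : Fin k → α} :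
    f ∈ injWords k s ↔ Function.Injective f ∧ ∀ i, f i ∈ s := by
  simp [injWords]

theorem sum_injWords_zero {M : Type*} [AddCommMonoid M] (s : Finset α) (φ : (Fin 0 → α) → M) :
    ∑ f ∈ injWords 0 s, φ f = φ Fin.elim0 := by
  have : injWords 0 s = {Fin.elim0} := by
    ext f
    simp [mem_injWords, Function.injective_of_subsingleton, Subsingleton.elim f Fin.elim0]
  rw [this, Finset.sum_singleton]

theorem sum_injWords_succ {M : Type*} [AddCommMonoid M] (k : ℕ) (s : Finset α)
    (φ : (Fin (k + 1) → α) → M) :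
    ∑ f ∈ injWords (k + 1) s, φ f =
      ∑ x ∈ s, ∑ g ∈ injWords k (s.erase x), φ (Fin.cons x g) := by
  rw [Finset.sum_sigma']
  refine Finset.sum_bij' (fun f _ => ⟨f 0, Fin.tail f⟩) (fun p _ => Fin.cons p.1 p.2) ?_ ?_ ?_ ?_ ?_
  · intro f hf
    rw [mem_injWords] at hf
    simp only [Finset.mem_sigma, mem_injWords, Finset.mem_erase]
    refine ⟨hf.2 0, fun i j h => Fin.succ_injective _ (hf.1 h), fun i => ⟨fun h => ?_, hf.2 _⟩⟩
    exact Fin.succ_ne_zero i (hf.1 h)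
  · rintro ⟨x, g⟩ hp
    simp only [Finset.mem_sigma, mem_injWords, Finset.mem_erase] at hp
    rw [mem_injWords]
    refine ⟨Fin.cons_injective_iff.2 ⟨?_, hp.2.1⟩, fun i => ?_⟩
    · rintro ⟨i, hi⟩
      exact (hp.2.2 i).1 hi
    · refine Fin.cases ?_ (fun i => ?_) i
      · exact hp.1
      · exact (hp.2.2 i).2
  · intro f _
    exact Fin.cons_self_tail f
  · intro p _
    simp
  · intro f _
    exact congrArg φ (Fin.cons_self_tail f).symm

/-- The descent enumerator of the words in `injWords k s`. -/
noncomputable def wordSum (z : R) (k : ℕ) (s : Finset α) : R :=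
  ∑ f ∈ injWords k s, z ^ descents f

/-- The descent enumerator of the words in `injWords k s` preceded by the letter `a`. -/
noncomputable def consWordSum (z : R) (k : ℕ) (s : Finset α) (a : α) : R :=
  ∑ f ∈ injWords k s, z ^ descents (Fin.cons a f : Fin (k + 1) → α)

theorem wordSum_zero (z : R) (s : Finset α) : wordSum z 0 s = 1 := by
  rw [wordSum, sum_injWords_zero]
  simp [descents]

theorem consWordSum_zero (z : R) (s : Finset α) (a : α) : consWordSum z 0 s a = 1 := by
  rw [consWordSum, sum_injWords_zero, descents, Finset.filter_false_of_mem, Finset.card_empty,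
    pow_zero]
  rintro i - ⟨h, -⟩
  exact absurd h (by omega)

theorem wordSum_succ (z : R) (k : ℕ) (s : Finset α) :
    wordSum z (k + 1) s = ∑ x ∈ s, consWordSum z k (s.erase x) x := by
  rw [wordSum, sum_injWords_succ]
  rfl

theorem consWordSum_succ (z : R) (k : ℕ) (s : Finset α) (a : α) :
    consWordSum z (k + 1) s a =
      ∑ x ∈ s, (if x < a then z else 1) * consWordSum z k (s.erase x) x := by
  rw [consWordSum, sum_injWords_succ]
  refine Finset.sum_congr rfl fun x _ => ?_
  rw [consWordSum, Finset.mul_sum]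
  refine Finset.sum_congr rfl fun g _ => ?_
  rw [descents_cons, pow_add]
  congr 1
  simp only [Fin.cons_zero]
  split_ifs <;> simp

/-- Give each descent the weight `1 + t` and mark it when `t` is chosen. The run of marked descents
starting at `a` is a decreasing sequence, hence determined by its set `B` of letters below `a`; the
remaining word is unconstrained, since the step after the run contributes `1` whether or not it is a
descent. -/
theorem consWordSum_eq (t : R) (k : ℕ) (s : Finset α) (hs : s.card = k) (a : α) :
    consWordSum (1 + t) k s a =
      ∑ B ∈ (s.filter (· < a)).powerset, t ^ B.card * wordSum (1 + t) (k - B.card) (s \ B) := by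
  induction k generalizing s a with
  | zero =>
    rw [Finset.card_eq_zero] at hs
    subst hs
    simp [consWordSum_zero, wordSum_zero]
  | succ k ih =>
    rw [sum_powerset_by_max, consWordSum_succ]
    -- The unmarked terms reassemble into the full word sum (`B = ∅`); in the marked terms `x`
    -- becomes the maximum of `B`.
    have h1 : ∀ x ∈ s, (if x < a then 1 + t else 1) * consWordSum (1 + t) k (s.erase x) x =
        consWordSum (1 + t) k (s.erase x) x +
          if x < a then t * consWordSum (1 + t) k (s.erase x) x else 0 := by
      intro x _
      split_ifs <;> ring
    rw [Finset.sum_congr rfl h1, Finset.sum_add_distrib, ← wordSum_succ, ← Finset.sum_filter]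
    simp only [Finset.card_empty, pow_zero, one_mul, Nat.sub_zero, Finset.sdiff_empty]
    congr 1
    refine Finset.sum_congr rfl fun x hx => ?_
    rw [Finset.mem_filter] at hx
    rw [ih (s.erase x) (by rw [Finset.card_erase_of_mem hx.1, hs]; rfl) x, Finset.mul_sum]
    have h2 : (s.erase x).filter (· < x) = (s.filter (· < a)).filter (· < x) := by
      ext y
      simp only [Finset.mem_filter, Finset.mem_erase]
      exact ⟨fun h => ⟨⟨h.1.2, h.2.trans hx.2⟩, h.2⟩, fun h => ⟨⟨h.2.ne, h.1.1⟩, h.2⟩⟩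
    rw [h2]
    refine Finset.sum_congr rfl fun B hB => ?_
    have hxB : x ∉ B := by
      intro h
      have := Finset.mem_powerset.1 hB h
      simp at this
    rw [Finset.card_insert_of_notMem hxB, Nat.add_sub_add_right, ← mul_assoc, ← pow_succ']
    congr 2
    ext y
    simp only [Finset.mem_sdiff, Finset.mem_erase, Finset.mem_insert]
    tauto

/-- The block `B` is the first letter together with the run of marked descents after it. The first
letter is `max B` and is not itself marked, whence the exponent `#B - 1`. -/
theorem wordSum_rec (t : R) (s : Finset α) (hs : s.Nonempty) :
    wordSum (1 + t) s.card s = ∑ B ∈ s.powerset.erase ∅,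
      t ^ (B.card - 1) * wordSum (1 + t) (s \ B).card (s \ B) := by
  obtain ⟨k, hk⟩ := Nat.exists_eq_succ_of_ne_zero hs.card_pos.ne'
  have key := sum_powerset_by_max s fun B => if B = ∅ then 0 else
    t ^ (B.card - 1) * wordSum (1 + t) (s \ B).card (s \ B)
  rw [if_pos rfl, zero_add, ← Finset.add_sum_erase _ _ (Finset.empty_mem_powerset s), if_pos rfl,
    zero_add] at key
  have h1 : ∑ B ∈ s.powerset.erase ∅, t ^ (B.card - 1) * wordSum (1 + t) (s \ B).card (s \ B) =
      ∑ B ∈ s.powerset.erase ∅, if B = ∅ then 0 else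
        t ^ (B.card - 1) * wordSum (1 + t) (s \ B).card (s \ B) :=
    Finset.sum_congr rfl fun B hB => by rw [if_neg (Finset.ne_of_mem_erase hB)]
  rw [h1, key, hk, Nat.succ_eq_add_one, wordSum_succ]
  refine Finset.sum_congr rfl fun x hx => ?_
  have hc : (s.erase x).card = k := by rw [Finset.card_erase_of_mem hx, hk]; rfl
  rw [consWordSum_eq t k _ hc x]
  have h2 : (s.erase x).filter (· < x) = s.filter (· < x) := by
    ext y
    simp only [Finset.mem_filter, Finset.mem_erase]
    exact ⟨fun h => ⟨h.1.2, h.2⟩, fun h => ⟨⟨h.2.ne, h.1⟩, h.2⟩⟩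
  rw [h2]
  refine Finset.sum_congr rfl fun B hB => ?_
  have hB' : B ⊆ s.erase x := by
    rw [← h2] at hB
    exact (Finset.mem_powerset.1 hB).trans (Finset.filter_subset _ _)
  have hxB : x ∉ B := fun h => Finset.notMem_erase x s (hB' h)
  have h3 : s \ insert x B = s.erase x \ B := by
    ext y
    simp only [Finset.mem_sdiff, Finset.mem_erase, Finset.mem_insert]
    tauto
  rw [if_neg (Finset.insert_ne_empty _ _), Finset.card_insert_of_notMem hxB, h3,
    Finset.card_sdiff_of_subset hB', hc, Nat.add_sub_cancel]

theorem eulerianPoly_eq_wordSum (k : ℕ) :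
    eulerianPoly k = wordSum (X : ℤ[X]) k (Finset.univ : Finset (Fin k)) := by
  unfold eulerianPoly wordSum
  refine Finset.sum_bij (fun σ _ => ⇑σ) ?_ ?_ ?_ ?_
  · intro σ _
    simp [mem_injWords, σ.injective]
  · intro σ _ τ _ h
    exact DFunLike.coe_injective h
  · intro f hf
    rw [mem_injWords] at hf
    exact ⟨Equiv.ofBijective f (Finite.injective_iff_bijective.1 hf.1), Finset.mem_univ _, rfl⟩
  · intro σ _
    rfl

end Eulerian

/-! ### Functions of finite sets satisfying the block recursion. -/

section BlockRecursion

variable {R : Type*} [CommRing R]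

/-- A function of finite sets satisfies the recursion of the enumerator of ordered set partitions
in which a block `B` has weight `t ^ (#B - 1)`. -/
def BlockRecursive {α : Type*} [DecidableEq α] (t : R) (Ψ : Finset α → R) : Prop :=
  Ψ ∅ = 1 ∧ ∀ s : Finset α, s.Nonempty →
    Ψ s = ∑ B ∈ s.powerset.erase ∅, t ^ (B.card - 1) * Ψ (s \ B)

/-- The recursion determines its solution and sees only cardinalities, so subsets can be transported
along any bijection. This is what identifies the face enumerators with Eulerian polynomials. -/
theorem BlockRecursive.eq_of_card_eq {α β : Type*} [DecidableEq α] [DecidableEq β] {t : R}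
    {Ψ : Finset α → R} {Φ : Finset β → R} (hΨ : BlockRecursive t Ψ) (hΦ : BlockRecursive t Φ)
    {s : Finset α} {u : Finset β} (h : s.card = u.card) : Ψ s = Φ u := by
  induction hk : s.card using Nat.strong_induction_on generalizing s u with
  | _ k ih =>
  rcases s.eq_empty_or_nonempty with rfl | hs
  · have : u = ∅ := by simpa using h.symm
    rw [this, hΨ.1, hΦ.1]
  · have hu : u.Nonempty := by rw [← Finset.card_pos, ← h]; exact hs.card_pos
    obtain ⟨e⟩ : Nonempty (s ≃ u) := ⟨Finset.equivOfCardEq h⟩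
    let E : Finset α → Finset β := fun B => (B.subtype (· ∈ s)).map
      (e.toEmbedding.trans (Function.Embedding.subtype _))
    let E' : Finset β → Finset α := fun B => (B.subtype (· ∈ u)).map
      (e.symm.toEmbedding.trans (Function.Embedding.subtype _))
    have hE : ∀ B, E B ⊆ u := by
      intro B y hy
      obtain ⟨x, -, rfl⟩ := Finset.mem_map.1 hy
      exact (e x).2
    have hE' : ∀ B, E' B ⊆ s := by
      intro B y hy
      obtain ⟨x, -, rfl⟩ := Finset.mem_map.1 hy
      exact (e.symm x).2
    have hEc : ∀ B ⊆ s, (E B).card = B.card := by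
      intro B hB
      rw [Finset.card_map, Finset.card_subtype, Finset.filter_true_of_mem hB]
    have hEc' : ∀ B ⊆ u, (E' B).card = B.card := by
      intro B hB
      rw [Finset.card_map, Finset.card_subtype, Finset.filter_true_of_mem hB]
    have hne : ∀ B ∈ s.powerset.erase ∅, B ⊆ s ∧ 0 < B.card := fun B hB =>
      ⟨Finset.mem_powerset.1 (Finset.mem_of_mem_erase hB),
        Finset.card_pos.2 (Finset.nonempty_iff_ne_empty.2 (Finset.ne_of_mem_erase hB))⟩
    have hne' : ∀ B ∈ u.powerset.erase ∅, B ⊆ u ∧ 0 < B.card := fun B hB =>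
      ⟨Finset.mem_powerset.1 (Finset.mem_of_mem_erase hB),
        Finset.card_pos.2 (Finset.nonempty_iff_ne_empty.2 (Finset.ne_of_mem_erase hB))⟩
    rw [hΨ.2 s hs, hΦ.2 u hu]
    refine Finset.sum_bij' (fun B _ => E B) (fun B _ => E' B) ?_ ?_ ?_ ?_ ?_
    · intro B hB
      refine Finset.mem_erase.2 ⟨?_, Finset.mem_powerset.2 (hE B)⟩
      rw [← Finset.nonempty_iff_ne_empty, ← Finset.card_pos, hEc B (hne B hB).1]
      exact (hne B hB).2
    · intro B hB
      refine Finset.mem_erase.2 ⟨?_, Finset.mem_powerset.2 (hE' B)⟩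
      rw [← Finset.nonempty_iff_ne_empty, ← Finset.card_pos, hEc' B (hne' B hB).1]
      exact (hne' B hB).2
    · intro B hB
      ext x
      have := (hne B hB).1
      simp only [E, E', Finset.mem_map, Finset.mem_subtype, Function.Embedding.trans_apply,
        Equiv.coe_toEmbedding, Function.Embedding.subtype_apply]
      constructor
      · rintro ⟨y, ⟨z, hz, hzy⟩, rfl⟩
        rw [← Subtype.ext hzy]
        simpa using hz
      · intro hx
        exact ⟨e ⟨x, this hx⟩, ⟨⟨x, this hx⟩, hx, rfl⟩, by simp⟩
    · intro B hB
      ext x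
      have := (hne' B hB).1
      simp only [E, E', Finset.mem_map, Finset.mem_subtype, Function.Embedding.trans_apply,
        Equiv.coe_toEmbedding, Function.Embedding.subtype_apply]
      constructor
      · rintro ⟨y, ⟨z, hz, hzy⟩, rfl⟩
        rw [← Subtype.ext hzy]
        simpa using hz
      · intro hx
        exact ⟨e.symm ⟨x, this hx⟩, ⟨⟨x, this hx⟩, hx, rfl⟩, by simp⟩
    · intro B hB
      obtain ⟨h1, h2⟩ := hne B hB
      have h3 := Finset.card_le_card h1
      rw [hEc B h1]
      congr 1
      refine ih _ ?_ ?_ rfl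
      · rw [Finset.card_sdiff_of_subset h1]; omega
      · rw [Finset.card_sdiff_of_subset h1, Finset.card_sdiff_of_subset (hE B), hEc B h1, h]

theorem blockRecursive_wordSum {α : Type*} [LinearOrder α] [Fintype α] (t : R) :
    BlockRecursive t fun s : Finset α => wordSum (1 + t) s.card s :=
  ⟨by simp [wordSum_zero], fun s hs => wordSum_rec t s hs⟩

theorem BlockRecursive.eq_eulerianPoly {α : Type*} [DecidableEq α] {Ψ : Finset α → ℤ[X]}
    (hΨ : BlockRecursive (X - 1) Ψ) (s : Finset α) : Ψ s = eulerianPoly s.card := by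
  rw [eulerianPoly_eq_wordSum]
  have := hΨ.eq_of_card_eq (blockRecursive_wordSum (α := Fin s.card) (X - 1 : ℤ[X]))
    (s := s) (u := Finset.univ) (by simp)
  rw [this]
  simp

/-- The empty block gives `Ψ s`, and the others give `t` times the recursion. -/
theorem BlockRecursive.sum_powerset {α : Type*} [DecidableEq α] {t : R} {Ψ : Finset α → R}
    (hΨ : BlockRecursive t Ψ) {s : Finset α} (hs : s.Nonempty) :
    ∑ B ∈ s.powerset, t ^ B.card * Ψ (s \ B) = (1 + t) * Ψ s := by
  rw [← Finset.add_sum_erase _ _ (Finset.empty_mem_powerset s), add_mul, one_mul]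
  simp only [Finset.card_empty, pow_zero, one_mul, Finset.sdiff_empty]
  conv_rhs => rw [hΨ.2 s hs]
  rw [Finset.mul_sum, ← hΨ.2 s hs]
  congr 1
  refine Finset.sum_congr rfl fun B hB => ?_
  have : 0 < B.card :=
    Finset.card_pos.2 (Finset.nonempty_iff_ne_empty.2 (Finset.ne_of_mem_erase hB))
  rw [← mul_assoc, ← pow_succ', Nat.sub_add_cancel this]

/-- Expand `(1 + t) ^ #(U \ M)` over subsets `Z` of `U \ M` and regroup by `K = M ∪ Z`; each
nonempty `K` then contributes `(1 + t) * Ψ K`. -/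
theorem BlockRecursive.sum_pow_sdiff {α : Type*} [DecidableEq α] {t : R} {Ψ : Finset α → R}
    (hΨ : BlockRecursive t Ψ) (U : Finset α) :
    ∑ M ∈ U.powerset, (1 + t) ^ (U \ M).card * Ψ M =
      1 + (1 + t) * ∑ K ∈ U.powerset.erase ∅, Ψ K := by
  have h1 : ∀ M ∈ U.powerset, (1 + t) ^ (U \ M).card * Ψ M =
      ∑ Z ∈ (U \ M).powerset, t ^ Z.card * Ψ M := by
    intro M _
    rw [← Finset.sum_mul, add_comm 1 t, ← Finset.sum_pow_mul_eq_add_pow]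
    simp
  have h2 : ∑ K ∈ U.powerset, ∑ Z ∈ K.powerset, t ^ Z.card * Ψ (K \ Z) =
      1 + (1 + t) * ∑ K ∈ U.powerset.erase ∅, Ψ K := by
    rw [← Finset.add_sum_erase _ _ (Finset.empty_mem_powerset U), Finset.mul_sum]
    congr 1
    · simp [hΨ.1]
    · exact Finset.sum_congr rfl fun K hK =>
        hΨ.sum_powerset (Finset.nonempty_iff_ne_empty.2 (Finset.ne_of_mem_erase hK))
  rw [← h2, Finset.sum_congr rfl h1, Finset.sum_sigma', Finset.sum_sigma']
  refine Finset.sum_bij' (fun p _ => ⟨p.1 ∪ p.2, p.2⟩) (fun p _ => ⟨p.1 \ p.2, p.2⟩) ?_ ?_ ?_ ?_ ?_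
  · rintro ⟨M, Z⟩ h
    simp only [Finset.mem_sigma, Finset.mem_powerset] at h ⊢
    exact ⟨Finset.union_subset h.1 (h.2.trans Finset.sdiff_subset), Finset.subset_union_right⟩
  · rintro ⟨K, Z⟩ h
    simp only [Finset.mem_sigma, Finset.mem_powerset] at h ⊢
    exact ⟨Finset.sdiff_subset.trans h.1, fun x hx => Finset.mem_sdiff.2
      ⟨h.1 (h.2 hx), fun h' => (Finset.mem_sdiff.1 h').2 hx⟩⟩
  · rintro ⟨M, Z⟩ h
    simp only [Finset.mem_sigma, Finset.mem_powerset] at h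
    have : Disjoint M Z := Finset.disjoint_right.2 fun x hx => (Finset.mem_sdiff.1 (h.2 hx)).2
    simp [Finset.union_sdiff_cancel_right this]
  · rintro ⟨K, Z⟩ h
    simp only [Finset.mem_sigma, Finset.mem_powerset] at h
    simp [Finset.sdiff_union_of_subset h.2]
  · rintro ⟨M, Z⟩ h
    simp only [Finset.mem_sigma, Finset.mem_powerset] at h
    have : Disjoint M Z := Finset.disjoint_right.2 fun x hx => (Finset.mem_sdiff.1 (h.2 hx)).2
    simp [Finset.union_sdiff_cancel_right this]

theorem binomialEulerianPoly_eq_sum {n : ℕ} {Ψ : Finset (Fin n) → ℤ[X]}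
    (hΨ : BlockRecursive (X - 1) Ψ) :
    ∑ M : Finset (Fin n), X ^ (n - M.card) * Ψ M = binomialEulerianPoly n := by
  have h := hΨ.sum_pow_sdiff Finset.univ
  rw [add_sub_cancel, Finset.powerset_univ] at h
  have h1 : ∀ M : Finset (Fin n), (Finset.univ \ M).card = n - M.card := fun M => by
    rw [Finset.card_univ_sdiff, Fintype.card_fin]
  simp only [h1] at h
  rw [h, binomialEulerianPoly]
  congr 2
  have h2 := Finset.sum_powerset_apply_card
    (fun k => if k = 0 then 0 else eulerianPoly k) (x := (Finset.univ : Finset (Fin n)))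
  rw [Finset.powerset_univ, ← Finset.add_sum_erase _ _ (Finset.mem_univ ∅), Finset.card_empty,
    if_pos rfl, zero_add, Finset.card_univ, Fintype.card_fin] at h2
  have h3 : ∑ K ∈ Finset.univ.erase (∅ : Finset (Fin n)), Ψ K =
      ∑ K ∈ Finset.univ.erase (∅ : Finset (Fin n)),
        if K.card = 0 then 0 else eulerianPoly K.card :=
    Finset.sum_congr rfl fun K hK => by
      rw [if_neg, hΨ.eq_eulerianPoly]
      simpa using hK
  rw [h3, h2, Finset.sum_range_succ', if_pos rfl, smul_zero, add_zero, Finset.range_eq_Ico,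
    Finset.sum_Ico_add' (fun k => n.choose k • if k = 0 then 0 else eulerianPoly k) 0 n 1]
  refine Finset.sum_congr rfl fun k hk => ?_
  rw [if_neg (by have := (Finset.mem_Ico.1 hk).1; omega)]
  simp

end BlockRecursion

/-! ### Packed functions as ordered set partitions, and the generating function of pairs. -/

section Packed

variable {n : ℕ}

/-- The positive values of `f` form an initial segment of the positive integers. -/
def IsPacked (f : Fin n → ℕ) : Prop := ∀ i v, 0 < v → v ≤ f i → ∃ j, f j = v

/-- The support of `f`, as a finite set. -/
def supp (f : Fin n → ℕ) : Finset (Fin n) := Finset.univ.filter fun i => 0 < f i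

/-- The largest value of `f`. -/
def top (f : Fin n → ℕ) : ℕ := Finset.univ.sup f

theorem mem_supp {f : Fin n → ℕ} {i : Fin n} : i ∈ supp f ↔ 0 < f i := by simp [supp]

theorem le_top (f : Fin n → ℕ) (i : Fin n) : f i ≤ top f := Finset.le_sup (Finset.mem_univ i)

theorem IsPacked.exists_eq {f : Fin n → ℕ} (hf : IsPacked f) {v : ℕ} (hv : 0 < v)
    (hv' : v ≤ top f) : ∃ j, f j = v := by
  obtain ⟨i, -, hi⟩ := (Finset.le_sup_iff (show ⊥ < v from hv)).1 hv'
  exact hf i v hv hi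

/-- Ensures that the natural-number subtractions in `packedSum` and `faceDim` are never truncated.
-/
theorem IsPacked.top_le {f : Fin n → ℕ} (hf : IsPacked f) : top f ≤ (supp f).card := by
  have : Finset.Icc 1 (top f) ⊆ (supp f).image f := by
    intro v hv
    rw [Finset.mem_Icc] at hv
    obtain ⟨j, hj⟩ := hf.exists_eq hv.1 hv.2
    exact Finset.mem_image.2 ⟨j, mem_supp.2 (by omega), hj⟩
  simpa using (Finset.card_le_card this).trans Finset.card_image_le

/-- The finite set of packed functions. -/
noncomputable def packed (n : ℕ) : Finset (Fin n → ℕ) :=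
  open Classical in (Fintype.piFinset fun _ => Finset.range (n + 1)).filter IsPacked

theorem mem_packed {f : Fin n → ℕ} : f ∈ packed n ↔ IsPacked f := by
  simp only [packed, Finset.mem_filter, Fintype.mem_piFinset, Finset.mem_range, and_iff_right_iff_imp]
  intro hf i
  have h1 := hf.top_le
  have h2 := le_top f i
  have h3 : (supp f).card ≤ n := by simpa using Finset.card_le_univ (supp f)
  omega

/-- Raise `g` by one on `M`. -/
def raise (M : Finset (Fin n)) (g : Fin n → ℕ) : Fin n → ℕ := fun i => if i ∈ M then g i + 1 else 0

theorem top_raise {M : Finset (Fin n)} {g : Fin n → ℕ} (hM : M.Nonempty) (hg : supp g ⊆ M) :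
    top (raise M g) = top g + 1 := by
  apply le_antisymm
  · refine Finset.sup_le fun i _ => ?_
    have := le_top g i
    unfold raise
    split_ifs <;> omega
  · obtain ⟨i, hi⟩ := hM
    rcases Nat.eq_zero_or_pos (top g) with h0 | h0
    · have := le_top (raise M g) i
      simp only [raise, if_pos hi] at this
      omega
    · obtain ⟨j, -, hj⟩ := (Finset.le_sup_iff (show ⊥ < top g from h0)).1 le_rfl
      have := le_top (raise M g) j
      simp only [raise, if_pos (hg (mem_supp.2 (h0.trans_le hj)))] at this
      omega

/-- Lowering `f` by one on its support deletes the lowest block, which is `M \ supp g` and is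
nonempty because `f` attains the value `1`. -/
theorem sum_packed_supp_eq {R : Type*} [AddCommMonoid R] {M : Finset (Fin n)} (hM : M.Nonempty)
    (φ : (Fin n → ℕ) → R) :
    ∑ f ∈ (packed n).filter (supp · = M), φ f =
      ∑ g ∈ (packed n).filter (supp · ⊂ M), φ (raise M g) := by
  refine Finset.sum_bij' (fun f _ i => f i - 1) (fun g _ => raise M g) ?_ ?_ ?_ ?_ ?_
  · intro f hf
    simp only [Finset.mem_filter, mem_packed] at hf ⊢
    obtain ⟨hf, rfl⟩ := hf
    refine ⟨fun i v hv hvi => ?_, ?_⟩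
    · dsimp only at hvi ⊢
      obtain ⟨j, hj⟩ := hf i (v + 1) (by omega) (by omega)
      exact ⟨j, by omega⟩
    · rw [Finset.ssubset_iff_of_subset]
      · obtain ⟨i, hi⟩ := hM
        obtain ⟨j, hj⟩ := hf i 1 one_pos (mem_supp.1 hi)
        exact ⟨j, mem_supp.2 (by omega), fun h => by rw [mem_supp] at h; omega⟩
      · intro i hi
        rw [mem_supp] at hi ⊢
        omega
  · intro g hg
    simp only [Finset.mem_filter, mem_packed] at hg ⊢
    obtain ⟨hg, hgM⟩ := hg
    refine ⟨fun i v hv hvi => ?_, ?_⟩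
    · by_cases hi : i ∈ M
      · simp only [raise, if_pos hi] at hvi
        rcases Nat.eq_or_lt_of_le hv with h1 | h1
        · obtain ⟨j, hj, hj'⟩ := Finset.exists_of_ssubset hgM
          rw [mem_supp] at hj'
          exact ⟨j, by simp only [raise, if_pos hj]; omega⟩
        · obtain ⟨j, hj⟩ := hg i (v - 1) (by omega) (by omega)
          have : j ∈ M := hgM.1 (mem_supp.2 (by omega))
          exact ⟨j, by simp only [raise, if_pos this]; omega⟩
      · simp only [raise, if_neg hi] at hvi
        omega
    · ext i
      rw [mem_supp, raise]
      split_ifs with h <;> simp [h]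
  · intro f hf
    simp only [Finset.mem_filter, mem_packed] at hf
    obtain ⟨hf, rfl⟩ := hf
    funext i
    simp only [raise, mem_supp]
    split_ifs <;> omega
  · intro g hg
    simp only [Finset.mem_filter, mem_packed] at hg
    funext i
    by_cases hi : i ∈ M
    · simp [raise, hi]
    · have : i ∉ supp g := fun h => hi (hg.2.1 h)
      rw [mem_supp] at this
      simp only [raise, if_neg hi]
      omega
  · intro f hf
    simp only [Finset.mem_filter, mem_packed] at hf
    obtain ⟨hf, rfl⟩ := hf
    congr 1
    funext i
    simp only [raise, mem_supp]
    split_ifs <;> omega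

variable {R : Type*} [CommRing R]

/-- The enumerator of the packed functions with support `M`. -/
noncomputable def packedSum (t : R) (M : Finset (Fin n)) : R :=
  ∑ f ∈ (packed n).filter (supp · = M), t ^ (M.card - top f)

theorem blockRecursive_packedSum (t : R) :
    BlockRecursive t (packedSum t : Finset (Fin n) → R) := by
  refine ⟨?_, fun M hM => ?_⟩
  · have : (packed n).filter (supp · = ∅) = {fun _ => 0} := by
      ext f
      simp only [Finset.mem_filter, mem_packed, Finset.mem_singleton]
      constructor
      · rintro ⟨-, h⟩
        funext i
        have : i ∉ supp f := by simp [h]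
        rw [mem_supp] at this
        omega
      · rintro rfl
        exact ⟨fun i v hv hv' => absurd hv' hv.not_ge, by ext; simp [mem_supp]⟩
    rw [packedSum, this]
    simp
  · rw [packedSum, sum_packed_supp_eq hM]
    have h1 : ∀ g ∈ (packed n).filter (supp · ⊂ M), M \ supp g ∈ M.powerset.erase ∅ := by
      intro g hg
      rw [Finset.mem_filter] at hg
      refine Finset.mem_erase.2 ⟨?_, Finset.mem_powerset.2 Finset.sdiff_subset⟩
      rw [Ne, Finset.sdiff_eq_empty_iff_subset]
      exact hg.2.2
    rw [← Finset.sum_fiberwise_of_maps_to h1]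
    refine Finset.sum_congr rfl fun B hB => ?_
    have hBM := Finset.mem_powerset.1 (Finset.mem_of_mem_erase hB)
    have hB0 : 0 < B.card :=
      Finset.card_pos.2 (Finset.nonempty_iff_ne_empty.2 (Finset.ne_of_mem_erase hB))
    rw [packedSum, Finset.mul_sum]
    have h2 : ((packed n).filter (supp · ⊂ M)).filter (fun g => M \ supp g = B) =
        (packed n).filter (supp · = M \ B) := by
      ext g
      simp only [Finset.mem_filter, and_assoc]
      refine and_congr_right fun _ => ⟨?_, ?_⟩
      · rintro ⟨h, rfl⟩
        rw [Finset.sdiff_sdiff_eq_self h.1]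
      · intro h
        rw [h]
        refine ⟨Finset.sdiff_ssubset hBM (Finset.card_pos.1 hB0), Finset.sdiff_sdiff_eq_self hBM⟩
    rw [h2]
    refine Finset.sum_congr rfl fun g hg => ?_
    simp only [Finset.mem_filter, mem_packed] at hg
    have h3 := hg.1.top_le
    rw [hg.2] at h3
    have h4 := Finset.card_sdiff_of_subset hBM
    have h5 := Finset.card_le_card hBM
    rw [top_raise hM (by rw [hg.2]; exact Finset.sdiff_subset), ← pow_add]
    congr 1
    omega

/-- The pairs of a packed function and a set of zeros of it. -/
noncomputable def signedPacked (n : ℕ) : Finset ((Fin n → ℕ) × Finset (Fin n)) :=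
  open Classical in ((packed n) ×ˢ Finset.univ).filter fun p => Disjoint (supp p.1) p.2

theorem mem_signedPacked {p : (Fin n → ℕ) × Finset (Fin n)} :
    p ∈ signedPacked n ↔ IsPacked p.1 ∧ ∀ i ∈ p.2, p.1 i = 0 := by
  simp only [signedPacked, Finset.mem_filter, Finset.mem_product, mem_packed, Finset.mem_univ,
    and_true, Finset.disjoint_right, mem_supp, not_lt, Nat.le_zero]

/-- The dimension of the face indexed by a pair. -/
def faceDim (p : (Fin n → ℕ) × Finset (Fin n)) : ℕ := n - p.2.card - top p.1

/-- For fixed `f` with support `M`, the set `N` ranges over all subsets of the complement of `M`,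
and the binomial theorem applies. -/
theorem sum_signedPacked (t : R) :
    ∑ p ∈ signedPacked n, t ^ faceDim p =
      ∑ M : Finset (Fin n), (1 + t) ^ (n - M.card) * packedSum t M := by
  rw [signedPacked, Finset.sum_filter, Finset.sum_product]
  simp_rw [packedSum, Finset.mul_sum]
  rw [← Finset.sum_fiberwise (packed n) supp]
  refine Finset.sum_congr rfl fun M _ => Finset.sum_congr rfl fun f hf => ?_
  rw [Finset.mem_filter, mem_packed] at hf
  obtain ⟨hf, rfl⟩ := hf
  rw [← Finset.sum_filter]
  have h1 : Finset.univ.filter (fun N => Disjoint (supp f) N) = (supp f)ᶜ.powerset := by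
    ext N
    simp only [Finset.mem_filter, Finset.mem_univ, true_and, Finset.mem_powerset]
    exact Finset.subset_compl_iff_disjoint_left.symm
  have h2 : (supp f)ᶜ.card = n - (supp f).card := by rw [Finset.card_compl, Fintype.card_fin]
  rw [h1, ← h2, ← Finset.sum_pow_mul_eq_add_pow, Finset.sum_mul]
  refine Finset.sum_congr rfl fun N hN => ?_
  rw [one_pow, one_mul, ← pow_add]
  congr 1
  have h3 := Finset.card_le_card (Finset.mem_powerset.1 hN)
  have h4 := hf.top_le
  have h5 : (supp f).card ≤ n := by simpa using Finset.card_le_univ (supp f)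
  unfold faceDim
  dsimp only
  omega

/-- The pairs `(f, ∅)` for which `f` has a unique minimum. -/
def IsDegenerate (p : (Fin n → ℕ) × Finset (Fin n)) : Prop :=
  p.2 = ∅ ∧ ∃ i, ∀ j, j ≠ i → p.1 i < p.1 j

/-- Either `f i = 0` and the support is everything else, or `f` is positive everywhere with lowest
block `{i}`. Both cases carry an ordered set partition of the other coordinates, with one fewer
block in the first case, hence the factors `t` and `1`. -/
theorem sum_packed_unique_min (t : R) (i : Fin n) :
    ∑ f ∈ (packed n).filter (fun f => ∀ j, j ≠ i → f i < f j), t ^ (n - top f) =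
      (1 + t) * packedSum t (Finset.univ.erase i) := by
  have hcard : (Finset.univ.erase i).card = n - 1 := by simp
  have hn : 0 < n := i.pos
  have hmin : ∀ f : Fin n → ℕ, f i = 0 →
      ((∀ j, j ≠ i → f i < f j) ↔ supp f = Finset.univ.erase i) := by
    intro f hf
    rw [hf, Finset.ext_iff]
    simp only [mem_supp, Finset.mem_erase, Finset.mem_univ, and_true]
    refine ⟨fun h j => ⟨?_, h j⟩, fun h j hj => (h j).2 hj⟩
    rintro h' rfl
    omega
  have h0 : (packed n).filter (fun f => (∀ j, j ≠ i → f i < f j) ∧ f i = 0) =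
      (packed n).filter (supp · = Finset.univ.erase i) := by
    refine Finset.filter_congr fun f _ => ?_
    by_cases hf : f i = 0
    · rw [← hmin f hf]
      tauto
    · refine ⟨fun h => absurd h.2 hf, fun h => ?_⟩
      have : i ∉ supp f := by simp [h]
      rw [mem_supp] at this
      omega
  have h1 : (packed n).filter (fun f => (∀ j, j ≠ i → f i < f j) ∧ ¬ f i = 0) =
      ((packed n).filter (supp · = Finset.univ)).filter (fun f => ∀ j, j ≠ i → f i < f j) := by
    rw [Finset.filter_filter]
    refine Finset.filter_congr fun f _ => ?_
    rw [and_comm]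
    refine and_congr_left fun h => ⟨fun hi => ?_, fun hs => ?_⟩
    · refine Finset.eq_univ_of_forall fun j => mem_supp.2 ?_
      by_cases hj : j = i
      · subst hj; omega
      · have := h j hj; omega
    · have : i ∈ supp f := by simp [hs]
      rw [mem_supp] at this
      omega
  have h2 : ((packed n).filter (supp · ⊂ Finset.univ)).filter
      (fun g => ∀ j, j ≠ i → raise Finset.univ g i < raise Finset.univ g j) =
      (packed n).filter (supp · = Finset.univ.erase i) := by
    rw [Finset.filter_filter]
    refine Finset.filter_congr fun g _ => ?_
    simp only [raise, Finset.mem_univ, if_true, add_lt_add_iff_right]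
    constructor
    · rintro ⟨hs, h⟩
      obtain ⟨k, -, hk⟩ := Finset.exists_of_ssubset hs
      rw [mem_supp] at hk
      have hki : k = i := by
        by_contra hki
        have := h k hki
        omega
      subst hki
      exact (hmin g (by omega)).1 h
    · intro h
      have : i ∉ supp g := by simp [h]
      have h' := this
      rw [mem_supp] at h'
      exact ⟨Finset.ssubset_univ_iff.2 fun h'' => this (by simp [h'']), (hmin g (by omega)).2 h⟩
  rw [← Finset.sum_filter_add_sum_filter_not _ (fun f => f i = 0), Finset.filter_filter,
    Finset.filter_filter, h0, h1, Finset.sum_filter (s := (packed n).filter (supp · = Finset.univ)),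
    sum_packed_supp_eq ⟨i, Finset.mem_univ i⟩
      (fun f => if ∀ j, j ≠ i → f i < f j then t ^ (n - top f) else 0),
    ← Finset.sum_filter (s := (packed n).filter (supp · ⊂ Finset.univ)), h2, add_comm, add_mul, one_mul, packedSum, Finset.mul_sum]
  congr 1
  · refine Finset.sum_congr rfl fun g hg => ?_
    rw [top_raise ⟨i, Finset.mem_univ i⟩ (Finset.subset_univ _), hcard]
    congr 1
    omega
  · refine Finset.sum_congr rfl fun g hg => ?_
    rw [Finset.mem_filter, mem_packed] at hg
    have := hg.1.top_le
    rw [hg.2, hcard] at this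
    rw [hcard, ← pow_succ']
    congr 1
    omega

open Classical in
theorem sum_signedPacked_degenerate (t : R) :
    ∑ p ∈ (signedPacked n).filter IsDegenerate, t ^ faceDim p =
      ∑ i : Fin n, (1 + t) * packedSum t (Finset.univ.erase i) := by
  have h1 : (signedPacked n).filter IsDegenerate =
      ((packed n).filter fun f => ∃ i, ∀ j, j ≠ i → f i < f j).image
        fun f => (f, ∅) := by
    ext ⟨f, N⟩
    simp only [Finset.mem_filter, mem_signedPacked, IsDegenerate, Finset.mem_image, mem_packed,
      Prod.mk.injEq]
    constructor
    · rintro ⟨⟨hf, -⟩, rfl, h⟩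
      exact ⟨f, ⟨hf, h⟩, rfl, rfl⟩
    · rintro ⟨g, ⟨hf, h⟩, rfl, rfl⟩
      exact ⟨⟨hf, by simp⟩, rfl, h⟩
  rw [h1, Finset.sum_image fun f _ g _ h => congrArg Prod.fst h]
  simp only [faceDim, Finset.card_empty, Nat.sub_zero]
  have h2 : ((packed n).filter fun f => ∃ i, ∀ j, j ≠ i → f i < f j) =
      Finset.univ.biUnion fun i : Fin n =>
        (packed n).filter fun f => ∀ j, j ≠ i → f i < f j := by
    ext f
    simp
  rw [h2, Finset.sum_biUnion]
  · exact Finset.sum_congr rfl fun i _ => sum_packed_unique_min t i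
  · intro i _ j _ hij
    refine Finset.disjoint_left.2 fun f hf hf' => ?_
    have h3 := (Finset.mem_filter.1 hf).2 j hij.symm
    have h4 := (Finset.mem_filter.1 hf').2 i hij
    omega

theorem sum_signedPacked_eq :
    ∑ p ∈ signedPacked n, (X - 1 : ℤ[X]) ^ faceDim p = binomialEulerianPoly n := by
  rw [sum_signedPacked, ← binomialEulerianPoly_eq_sum (blockRecursive_packedSum _)]
  simp

open Classical in
theorem sum_signedPacked_not_degenerate_eq :
    ∑ p ∈ (signedPacked n).filter (fun p => ¬ IsDegenerate p), (X - 1 : ℤ[X]) ^ faceDim p =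
      binomialEulerianPoly n - C (n : ℤ) * X * eulerianPoly (n - 1) := by
  rw [← sum_signedPacked_eq, ← Finset.sum_filter_add_sum_filter_not (signedPacked n) IsDegenerate,
    sum_signedPacked_degenerate]
  simp [(blockRecursive_packedSum (X - 1 : ℤ[X])).eq_eulerianPoly, mul_assoc]

end Packed

/-! ### Inequalities and distinguished points of the polytope. -/

section Vertices

variable {n : ℕ} {b : Fin n → ℕ}

/-- The bound `b₁ + ⋯ + bᵢ` on the `i`-th smallest entry of a parking function. -/
def bound (b : Fin n → ℕ) (i : Fin n) : ℕ := ∑ j ∈ Finset.Iic i, b j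

theorem bound_strictMono (hb : ∀ i, 0 < b i) : StrictMono (bound b) := by
  intro i j hij
  refine Finset.sum_lt_sum_of_subset (Finset.Iic_subset_Iic.2 hij.le) (Finset.mem_Iic.2 le_rfl)
    (fun h => ?_) (hb j) fun _ _ _ => Nat.zero_le _
  exact absurd (Finset.mem_Iic.1 h) hij.not_ge

theorem bound_pos (hb : ∀ i, 0 < b i) (i : Fin n) : 0 < bound b i :=
  Finset.sum_pos (fun j _ => hb j) ⟨i, Finset.mem_Iic.2 le_rfl⟩

theorem bound_zero (hn : 0 < n) : bound b ⟨0, hn⟩ = b ⟨0, hn⟩ := by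
  have : Finset.Iic (⟨0, hn⟩ : Fin n) = {⟨0, hn⟩} := by
    ext j
    simp [Fin.le_def, Fin.ext_iff]
  rw [bound, this, Finset.sum_singleton]

/-- The sum of the `k` largest bounds. -/
def topSum (b : Fin n → ℕ) (k : ℕ) : ℕ := ∑ j : Fin n with n ≤ j.1 + k, bound b j

theorem topSum_zero : topSum b 0 = 0 := by
  rw [topSum, Finset.filter_false_of_mem, Finset.sum_empty]
  intro j _
  omega

theorem topSum_eq_add (hn : 0 < n) : topSum b n = topSum b (n - 1) + b ⟨0, hn⟩ := by
  have h1 : (Finset.univ.filter fun j : Fin n => n ≤ j.1 + n) = Finset.univ := by simp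
  have h2 : (Finset.univ.filter fun j : Fin n => n ≤ j.1 + (n - 1)) =
      Finset.univ.erase ⟨0, hn⟩ := by
    ext j
    simp only [Finset.mem_filter, Finset.mem_univ, true_and, Finset.mem_erase, and_true, Ne,
      Fin.ext_iff]
    omega
  rw [topSum, topSum, h1, h2, ← bound_zero (b := b) hn, Finset.sum_erase_add _ _ (Finset.mem_univ _)]

/-- Exchange argument: `S \ T` and `T \ S` have equal size, and the smallest bound over `T`, at `a`,
separates their terms. -/
theorem sum_bound_le_topSum (hb : ∀ i, 0 < b i) (S : Finset (Fin n)) :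
    ∑ j ∈ S, bound b j ≤ topSum b S.card := by
  rcases S.eq_empty_or_nonempty with rfl | hS
  · simp
  have hk : S.card ≤ n := by simpa using Finset.card_le_univ S
  have hk0 := hS.card_pos
  let a : Fin n := ⟨n - S.card, by omega⟩
  set T := Finset.univ.filter fun j : Fin n => n ≤ j.1 + S.card with hT
  have hTa : ∀ j, j ∈ T ↔ a ≤ j := by
    intro j
    simp only [hT, Finset.mem_filter, Finset.mem_univ, true_and, Fin.le_def, a]
    omega
  have hTc : T.card = S.card := by
    have : T = Finset.Ici a := by ext j; rw [hTa, Finset.mem_Ici]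
    rw [this, Fin.card_Ici]
    simp only [a]
    omega
  have h1 : (S \ T).card = (T \ S).card := Finset.card_sdiff_comm hTc.symm
  have h2 : ∑ j ∈ S \ T, bound b j ≤ (S \ T).card • bound b a := by
    refine Finset.sum_le_card_nsmul _ _ _ fun j hj => ?_
    have : ¬ a ≤ j := fun h => (Finset.mem_sdiff.1 hj).2 ((hTa j).2 h)
    exact (bound_strictMono hb).monotone (le_of_not_ge this)
  have h3 : (T \ S).card • bound b a ≤ ∑ j ∈ T \ S, bound b j := by
    refine Finset.card_nsmul_le_sum _ _ _ fun j hj => ?_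
    exact (bound_strictMono hb).monotone ((hTa j).1 (Finset.mem_sdiff.1 hj).1)
  have h4 := Finset.sum_inter_add_sum_sdiff S T (bound b)
  have h5 := Finset.sum_inter_add_sum_sdiff T S (bound b)
  rw [Finset.inter_comm] at h5
  have h6 : topSum b S.card = ∑ j ∈ T, bound b j := rfl
  rw [h1] at h2
  omega

theorem sum_bound_eq_topSum {U : Finset (Fin n)} (hU : ∀ i ∈ U, ∀ j, i ≤ j → j ∈ U) :
    ∑ j ∈ U, bound b j = topSum b U.card := by
  rw [topSum]
  refine Finset.sum_congr ?_ fun _ _ => rfl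
  ext j
  simp only [Finset.mem_filter, Finset.mem_univ, true_and]
  constructor
  · intro hj
    have h1 := Finset.card_le_card
      (show Finset.Ici j ⊆ U from fun k hk => hU j hj k (Finset.mem_Ici.1 hk))
    rw [Fin.card_Ici] at h1
    omega
  · intro hj
    by_contra hjU
    have h1 := Finset.card_le_card (show U ⊆ Finset.Ioi j from fun k hk =>
      Finset.mem_Ioi.2 (lt_of_not_ge fun h => hjU (hU k hk j h)))
    rw [Fin.card_Ioi] at h1
    omega

theorem sum_bound_lt_topSum (hb : ∀ i, 0 < b i) {S : Finset (Fin n)} {i j : Fin n} (hi : i ∈ S)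
    (hj : j ∉ S) (hij : i < j) : ∑ k ∈ S, bound b k < topSum b S.card := by
  have hj' : j ∉ S.erase i := fun h => hj (Finset.mem_of_mem_erase h)
  have h1 := sum_bound_le_topSum hb (insert j (S.erase i))
  rw [Finset.card_insert_of_notMem hj', Finset.card_erase_add_one hi, Finset.sum_insert hj'] at h1
  have h2 := Finset.sum_erase_add S (bound b) hi
  have h3 := bound_strictMono hb hij
  omega

/-- Pigeonhole: if the sorted entry at `i` exceeded its bound, `π` would inject the positions from
`i` on into the indices strictly above `i`. -/
theorem isParkingFunction_of_le (hb : ∀ i, 0 < b i) {β : Fin n → ℕ} (hβ : ∀ i, 0 < β i)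
    (π : Equiv.Perm (Fin n)) (h : ∀ i, β i ≤ bound b (π i)) : IsParkingFunction b β := by
  refine ⟨hβ, fun i => ?_⟩
  by_contra hi
  change ¬ _ ≤ bound b i at hi
  have h1 : ∀ j ∈ Finset.Ici i, π (Tuple.sort β j) ∈ Finset.Ioi i := by
    intro j hj
    have h2 : β (Tuple.sort β i) ≤ β (Tuple.sort β j) :=
      Tuple.monotone_sort β (Finset.mem_Ici.1 hj)
    have h3 := h (Tuple.sort β j)
    exact Finset.mem_Ioi.2 ((bound_strictMono hb).lt_iff_lt.1 (by omega))
  have h2 := Finset.card_le_card_of_injOn (fun j => π (Tuple.sort β j)) h1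
    fun x _ y _ hxy => (Tuple.sort β).injective (π.injective hxy)
  rw [Fin.card_Ici, Fin.card_Ioi] at h2
  omega

theorem exists_le_bound_perm {β : Fin n → ℕ} (h : IsParkingFunction b β) :
    ∃ π : Equiv.Perm (Fin n), ∀ i, β i ≤ bound b (π i) :=
  ⟨(Tuple.sort β).symm, fun i => by simpa [bound] using h.2 ((Tuple.sort β).symm i)⟩

theorem sum_bound_perm (π : Equiv.Perm (Fin n)) (S : Finset (Fin n)) :
    ∑ i ∈ S, bound b (π i) = ∑ i ∈ S.map π.toEmbedding, bound b i := by
  rw [Finset.sum_map]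
  rfl

theorem one_le_of_mem {x : Fin n → ℝ} (hx : x ∈ parkingPolytope b) (i : Fin n) : 1 ≤ x i := by
  have hconv : Convex ℝ {x : Fin n → ℝ | 1 ≤ x i} :=
    convex_halfSpace_ge (LinearMap.proj (R := ℝ) (φ := fun _ : Fin n => ℝ) i).isLinear 1
  refine convexHull_min ?_ hconv hx
  rintro y ⟨β, hβ, hy⟩
  change 1 ≤ y i
  rw [hy]
  exact_mod_cast hβ.1 i

theorem sum_le_topSum (hb : ∀ i, 0 < b i) {x : Fin n → ℝ} (hx : x ∈ parkingPolytope b)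
    (S : Finset (Fin n)) : ∑ i ∈ S, x i ≤ topSum b S.card := by
  have hconv : Convex ℝ {x : Fin n → ℝ | ∑ i ∈ S, x i ≤ topSum b S.card} := by
    refine convex_halfSpace_le (f := fun x : Fin n → ℝ => ∑ i ∈ S, x i) ⟨fun x y => ?_, fun r x => ?_⟩ _
    · simp [Finset.sum_add_distrib]
    · simp [Finset.mul_sum]
  refine convexHull_min ?_ hconv hx
  rintro y ⟨β, hβ, hy⟩
  change ∑ i ∈ S, y i ≤ _
  obtain ⟨π, hπ⟩ := exists_le_bound_perm hβ
  simp only [hy]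
  have h1 := sum_bound_le_topSum hb (S.map π.toEmbedding)
  rw [← sum_bound_perm, Finset.card_map] at h1
  exact_mod_cast (Finset.sum_le_sum fun i _ => hπ i).trans h1

/-- The point with coordinate `1` on `T` and `bound b (π i)` at `i ∉ T`. -/
noncomputable def vertex (b : Fin n → ℕ) (π : Equiv.Perm (Fin n)) (T : Finset (Fin n)) :
    Fin n → ℝ := fun i => if i ∈ T then 1 else bound b (π i)

theorem vertex_mem (hb : ∀ i, 0 < b i) (π : Equiv.Perm (Fin n)) (T : Finset (Fin n)) :
    vertex b π T ∈ parkingPolytope b := by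
  refine subset_convexHull ℝ _ ⟨fun i => if i ∈ T then 1 else bound b (π i),
    isParkingFunction_of_le hb (fun i => ?_) π fun i => ?_, fun i => ?_⟩
  · have := bound_pos hb (π i)
    split_ifs <;> omega
  · have := bound_pos hb (π i)
    split_ifs <;> omega
  · simp [vertex]

theorem vertex_le (hb : ∀ i, 0 < b i) (π : Equiv.Perm (Fin n)) (T : Finset (Fin n)) (i : Fin n) :
    vertex b π T i ≤ bound b (π i) := by
  have : (1 : ℝ) ≤ bound b (π i) := by exact_mod_cast bound_pos hb (π i)
  unfold vertex
  split_ifs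
  · exact this
  · exact le_rfl

end Vertices

/-! ### Equations of the face maximizing a linear functional. -/

section MaxFace

variable {n : ℕ} {b : Fin n → ℕ}

/-- Abel summation: `c` is a positive combination of indicators of its superlevel sets, so the
pairing with `d` is a positive combination of the superlevel sums and vanishes only if each of them
does. -/
theorem abel_sum_nonneg {ι : Type*} [Fintype ι] (c d : ι → ℝ) (hc : ∀ i, 0 ≤ c i)
    (h : ∀ i, 0 < c i → 0 ≤ ∑ j with c i ≤ c j, d j) :
    0 ≤ ∑ i, c i * d i ∧
      (∑ i, c i * d i ≤ 0 → ∀ i, 0 < c i → ∑ j with c i ≤ c j, d j = 0) := by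
  induction hk : (Finset.univ.filter fun i => 0 < c i).card using Nat.strong_induction_on
    generalizing c with
  | _ k ih =>
  rcases (Finset.univ.filter fun i => 0 < c i).eq_empty_or_nonempty with h0 | h0
  · have h1 : ∀ i, ¬ 0 < c i := fun i hi => by
      have : i ∈ Finset.univ.filter fun i => 0 < c i := by simpa using hi
      rw [h0] at this
      simp at this
    have h2 : ∀ i, c i = 0 := fun i => le_antisymm (not_lt.1 (h1 i)) (hc i)
    exact ⟨by simp [h2], fun _ i hi => absurd hi (h1 i)⟩
  obtain ⟨i₀, hi₀, hmin⟩ := Finset.exists_min_image _ c h0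
  simp only [Finset.mem_filter, Finset.mem_univ, true_and] at hi₀ hmin
  -- Subtracting the least positive value peels off the largest superlevel set and leaves the higher
  -- ones unchanged.
  let c' : ι → ℝ := fun i => max (c i - c i₀) 0
  have hpos : ∀ i, 0 < c' i ↔ c i₀ < c i := by
    intro i
    simp [c']
  have hlev : ∀ i, 0 < c' i → ∀ j, c' i ≤ c' j ↔ c i ≤ c j := by
    intro i hi j
    have hi' := (hpos i).1 hi
    simp only [c']
    rw [max_eq_left (by linarith)]
    constructor
    · intro h1
      rcases le_max_iff.1 h1 with h2 | h2 <;> linarith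
    · intro h1
      exact le_max_of_le_left (by linarith)
  have hsum : ∑ i, c i * d i = c i₀ * ∑ j with c i₀ ≤ c j, d j + ∑ i, c' i * d i := by
    rw [Finset.mul_sum, Finset.sum_filter, ← Finset.sum_add_distrib]
    refine Finset.sum_congr rfl fun i _ => ?_
    simp only [c']
    split_ifs with h1
    · rw [max_eq_left (by linarith)]
      ring
    · have : c i = 0 := le_antisymm (not_lt.1 fun h2 => h1 (hmin i h2)) (hc i)
      rw [this, max_eq_right (by linarith)]
      ring
  have hcard : (Finset.univ.filter fun i => 0 < c' i).card < k := by
    rw [← hk]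
    refine Finset.card_lt_card ⟨fun i hi => ?_, fun h1 => ?_⟩
    · simp only [Finset.mem_filter, Finset.mem_univ, true_and] at hi ⊢
      exact hi₀.trans ((hpos i).1 hi)
    · have := h1 (show i₀ ∈ _ by simpa using hi₀)
      simp only [Finset.mem_filter, Finset.mem_univ, true_and] at this
      exact lt_irrefl _ ((hpos i₀).1 this)
  obtain ⟨ih1, ih2⟩ := ih _ hcard c' (fun i => le_max_right _ _) (fun i hi => by
    simp only [hlev i hi]
    exact h i (hi₀.trans ((hpos i).1 hi))) rfl
  have h1 := mul_nonneg hi₀.le (h i₀ hi₀)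
  rw [hsum]
  refine ⟨add_nonneg h1 ih1, fun hle i hi => ?_⟩
  rcases (hmin i hi).eq_or_lt with h2 | h2
  · rw [← h2]
    have h3 : c i₀ * ∑ j with c i₀ ≤ c j, d j = 0 := le_antisymm (by linarith) h1
    exact (mul_eq_zero.1 h3).resolve_left hi₀.ne'
  · have h3 := ih2 (by linarith) i ((hpos i).2 h2)
    simpa only [hlev i ((hpos i).2 h2)] using h3

/-- The points of `P` at which the functional with coefficients `c` is maximal. -/
def maxFace (P : Set (Fin n → ℝ)) (c : Fin n → ℝ) : Set (Fin n → ℝ) :=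
  {x ∈ P | ∀ y ∈ P, ∑ i, c i * y i ≤ ∑ i, c i * x i}

/-- The equations cutting out the face on which the functional `c` is maximal. -/
def Tight (b : Fin n → ℕ) (c x : Fin n → ℝ) : Prop :=
  (∀ i, c i < 0 → x i = 1) ∧
    ∀ i, 0 < c i → ∑ j with c i ≤ c j, x j = topSum b (Finset.univ.filter (c i ≤ c ·)).card

/-- `π` refines the weak order defined by `c`. -/
def Compatible (c : Fin n → ℝ) (π : Equiv.Perm (Fin n)) : Prop := ∀ i j, c i < c j → π i < π j

theorem exists_compatible (c : Fin n → ℝ) : ∃ π, Compatible c π := by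
  refine ⟨(Tuple.sort c).symm, fun i j hij => lt_of_not_ge fun h => ?_⟩
  have := Tuple.monotone_sort c h
  simp only [Function.comp, Equiv.apply_symm_apply] at this
  exact absurd hij this.not_gt

/-- Sorting lexicographically, with ties broken in favour of `j`. -/
theorem exists_compatible_lt {c : Fin n → ℝ} {i j : Fin n} (hij : i ≠ j) (h : c i ≤ c j) :
    ∃ π, Compatible c π ∧ π i < π j := by
  let key : Fin n → ℝ ×ₗ ℕ := fun k => toLex (c k, if k = j then 1 else 0)
  have hkey : ∀ k l, key k < key l → (Tuple.sort key).symm k < (Tuple.sort key).symm l := by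
    refine fun k l hkl => lt_of_not_ge fun h => ?_
    have := Tuple.monotone_sort key h
    simp only [Function.comp, Equiv.apply_symm_apply] at this
    exact absurd hkl this.not_gt
  refine ⟨(Tuple.sort key).symm, fun k l hkl => hkey k l ?_, hkey i j ?_⟩
  · exact Prod.Lex.toLex_lt_toLex.2 (Or.inl hkl)
  · refine Prod.Lex.toLex_lt_toLex.2 ?_
    rcases h.lt_or_eq with h1 | h1
    · exact Or.inl h1
    · exact Or.inr ⟨h1, by simp [hij]⟩

/-- A compatible `π` sends superlevel sets of `c` to final segments, where the bounds add up to
`topSum`. Coordinates with `c i = 0` may be placed in `T` or not, which later gives the directions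
inside the face. -/
theorem tight_vertex {c : Fin n → ℝ} {π : Equiv.Perm (Fin n)} (hπ : Compatible c π)
    {T : Finset (Fin n)} (hT : ∀ i, c i < 0 → i ∈ T) (hT' : ∀ i ∈ T, c i ≤ 0) :
    Tight b c (vertex b π T) := by
  refine ⟨fun i hi => if_pos (hT i hi), fun i hi => ?_⟩
  have h1 : ∑ j with c i ≤ c j, vertex b π T j = ∑ j with c i ≤ c j, (bound b (π j) : ℝ) := by
    refine Finset.sum_congr rfl fun j hj => if_neg fun hjT => ?_
    simp only [Finset.mem_filter, Finset.mem_univ, true_and] at hj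
    linarith [hT' j hjT]
  rw [h1, ← Nat.cast_sum, sum_bound_perm, sum_bound_eq_topSum, Finset.card_map]
  intro k hk l hkl
  simp only [Finset.mem_map, Finset.mem_filter, Finset.mem_univ, true_and,
    Equiv.coe_toEmbedding] at hk ⊢
  obtain ⟨j, hj, rfl⟩ := hk
  refine ⟨π.symm l, le_of_not_gt fun h => ?_, by simp⟩
  have := hπ _ _ (h.trans_le hj)
  rw [Equiv.apply_symm_apply] at this
  exact absurd hkl this.not_ge

/-- Split `c` into positive and negative parts: Abel summation handles the first through
`sum_le_topSum`, and `1 ≤ x i` handles the second. Equality makes every inequality used an equality.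
-/
theorem sum_mul_le_and_tight (hb : ∀ i, 0 < b i) {c w x : Fin n → ℝ} (hw : Tight b c w)
    (hx : x ∈ parkingPolytope b) :
    ∑ i, c i * x i ≤ ∑ i, c i * w i ∧ (∑ i, c i * w i ≤ ∑ i, c i * x i → Tight b c x) := by
  have hlev : ∀ i, 0 < max (c i) 0 → ∀ j, max (c i) 0 ≤ max (c j) 0 ↔ c i ≤ c j := by
    intro i hi j
    have hi' : 0 < c i := by simpa using hi
    rw [max_eq_left hi'.le, le_max_iff]
    exact ⟨fun h => h.resolve_right hi'.not_ge, Or.inl⟩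
  obtain ⟨h1, h2⟩ := abel_sum_nonneg (fun i => max (c i) 0) (fun i => w i - x i)
    (fun i => le_max_right _ _) (fun i hi => by
      simp only [hlev i hi]
      rw [Finset.sum_sub_distrib, hw.2 i (by simpa using hi)]
      linarith [sum_le_topSum hb hx (Finset.univ.filter (c i ≤ c ·))])
  have h3 : ∀ i, 0 ≤ min (c i) 0 * (w i - x i) := by
    intro i
    rcases le_or_gt 0 (c i) with h | h
    · rw [min_eq_right h, zero_mul]
    · rw [min_eq_left h.le, hw.1 i h]
      exact mul_nonneg_of_nonpos_of_nonpos h.le (by linarith [one_le_of_mem hx i])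
  have h4 : ∑ i, c i * w i - ∑ i, c i * x i =
      ∑ i, max (c i) 0 * (w i - x i) + ∑ i, min (c i) 0 * (w i - x i) := by
    rw [← Finset.sum_sub_distrib, ← Finset.sum_add_distrib]
    refine Finset.sum_congr rfl fun i _ => ?_
    rw [← add_mul, max_add_min]
    ring
  have h5 := Finset.sum_nonneg fun i (_ : i ∈ Finset.univ) => h3 i
  refine ⟨by linarith, fun hle => ⟨fun i hi => ?_, fun i hi => ?_⟩⟩
  · have h6 := (Finset.sum_eq_zero_iff_of_nonneg fun i _ => h3 i).1
      (le_antisymm (by linarith) h5) i (Finset.mem_univ i)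
    rw [min_eq_left hi.le, hw.1 i hi] at h6
    linarith [(mul_eq_zero.1 h6).resolve_left hi.ne]
  · have hi' : 0 < max (c i) 0 := by simpa using hi
    have h6 := h2 (by linarith) i hi'
    simp only [hlev i hi'] at h6
    rw [Finset.sum_sub_distrib, hw.2 i hi] at h6
    linarith

theorem mem_maxFace_iff (hb : ∀ i, 0 < b i) {c x : Fin n → ℝ} :
    x ∈ maxFace (parkingPolytope b) c ↔ x ∈ parkingPolytope b ∧ Tight b c x := by
  obtain ⟨π, hπ⟩ := exists_compatible c
  have hw : Tight b c (vertex b π (Finset.univ.filter (c · < 0))) :=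
    tight_vertex hπ (fun i hi => by simpa using hi) (fun i hi => by
      simp only [Finset.mem_filter, Finset.mem_univ, true_and] at hi
      exact hi.le)
  constructor
  · rintro ⟨hx, h⟩
    exact ⟨hx, (sum_mul_le_and_tight hb hw hx).2 (h _ (vertex_mem hb _ _))⟩
  · rintro ⟨hx, h⟩
    exact ⟨hx, fun y hy => (sum_mul_le_and_tight hb h hy).1⟩

theorem vertex_mem_maxFace (hb : ∀ i, 0 < b i) {c : Fin n → ℝ} {π : Equiv.Perm (Fin n)}
    (hπ : Compatible c π) {T : Finset (Fin n)} (hT : ∀ i, c i < 0 → i ∈ T)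
    (hT' : ∀ i ∈ T, c i ≤ 0) : vertex b π T ∈ maxFace (parkingPolytope b) c :=
  (mem_maxFace_iff hb).2 ⟨vertex_mem hb _ _, tight_vertex hπ hT hT'⟩

theorem maxFace_nonempty (hb : ∀ i, 0 < b i) (c : Fin n → ℝ) :
    (maxFace (parkingPolytope b) c).Nonempty := by
  obtain ⟨π, hπ⟩ := exists_compatible c
  exact ⟨_, vertex_mem_maxFace hb hπ (T := Finset.univ.filter (c · < 0))
    (fun i hi => by simpa using hi) (fun i hi => by
      simp only [Finset.mem_filter, Finset.mem_univ, true_and] at hi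
      exact hi.le)⟩

theorem isExposed_and_nonempty_iff (hb : ∀ i, 0 < b i) {F : Set (Fin n → ℝ)} :
    F.Nonempty ∧ IsExposed ℝ (parkingPolytope b) F ↔ ∃ c, F = maxFace (parkingPolytope b) c := by
  constructor
  · rintro ⟨hF, h⟩
    obtain ⟨l, hl⟩ := h hF
    have h1 : ∀ x, l x = ∑ i, l (Pi.single i 1) * x i := by
      intro x
      conv_lhs => rw [← Finset.univ_sum_single x, map_sum]
      refine Finset.sum_congr rfl fun i _ => ?_
      have : (Pi.single i (x i) : Fin n → ℝ) = x i • Pi.single i 1 := by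
        rw [← Pi.single_smul, smul_eq_mul, mul_one]
      rw [this, map_smul, smul_eq_mul, mul_comm]
    refine ⟨fun i => l (Pi.single i 1), ?_⟩
    rw [hl]
    simp only [maxFace, ← h1]
  · rintro ⟨c, rfl⟩
    refine ⟨maxFace_nonempty hb c, fun _ =>
      ⟨∑ i, c i • ContinuousLinearMap.proj (R := ℝ) (φ := fun _ : Fin n => ℝ) i, ?_⟩⟩
    simp [maxFace]

theorem maxFace_congr (hb : ∀ i, 0 < b i) {c c' : Fin n → ℝ} (hneg : ∀ i, c i < 0 ↔ c' i < 0)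
    (hpos : ∀ i, 0 < c i ↔ 0 < c' i) (hle : ∀ i j, 0 < c i → (c i ≤ c j ↔ c' i ≤ c' j)) :
    maxFace (parkingPolytope b) c = maxFace (parkingPolytope b) c' := by
  ext x
  rw [mem_maxFace_iff hb, mem_maxFace_iff hb, Tight, Tight]
  simp only [hneg]
  refine and_congr_right fun _ => and_congr_right fun _ => forall_congr' fun i => ?_
  rw [← hpos]
  refine imp_congr_right fun hi => ?_
  simp only [hle i _ hi]

end MaxFace

/-! ### Recovering the pair from its face, and the redundancy when `b₁ = 1`. -/

section Recovery

variable {n : ℕ} {b : Fin n → ℕ}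

/-- Every coordinate that is not forced to be `1` by `c` is larger than `1` somewhere on the
face defined by `c`. -/
def IsFree (b : Fin n → ℕ) (c : Fin n → ℝ) : Prop :=
  ∀ i, 0 ≤ c i → ∃ π, Compatible c π ∧ 2 ≤ bound b (π i)

theorem IsFree.neg_iff (hb : ∀ i, 0 < b i) {c : Fin n → ℝ} (hc : IsFree b c) (i : Fin n) :
    c i < 0 ↔ ∀ x ∈ maxFace (parkingPolytope b) c, x i = 1 := by
  refine ⟨fun hi x hx => ((mem_maxFace_iff hb).1 hx).2.1 i hi, fun h => ?_⟩
  by_contra hi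
  obtain ⟨π, hπ, h2⟩ := hc i (not_lt.1 hi)
  have := h _ (vertex_mem_maxFace hb hπ (T := Finset.univ.filter (c · < 0))
    (fun i hi => by simpa using hi) (fun i hi => by
      simp only [Finset.mem_filter, Finset.mem_univ, true_and] at hi
      exact hi.le))
  rw [vertex, if_neg (by simpa using hi)] at this
  have h3 : bound b (π i) = 1 := by exact_mod_cast this
  omega

theorem IsFree.pos_iff (hb : ∀ i, 0 < b i) {c : Fin n → ℝ} (hc : IsFree b c) {i : Fin n}
    (hi : 0 ≤ c i) :
    0 < c i ↔ ∃ S : Finset (Fin n), i ∈ S ∧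
      ∀ x ∈ maxFace (parkingPolytope b) c, ∑ j ∈ S, x j = topSum b S.card := by
  refine ⟨fun hi => ⟨Finset.univ.filter (c i ≤ c ·), by simp,
    fun x hx => ((mem_maxFace_iff hb).1 hx).2.2 i hi⟩, ?_⟩
  rintro ⟨S, hiS, hS⟩
  by_contra hi'
  obtain ⟨π, hπ, h2⟩ := hc i hi
  -- If `c i = 0`, the coordinate `i` can be lowered from a bound at least `2` to `1` without
  -- leaving the face, so no sum through `i` is tight.
  have h3 := hS _ (vertex_mem_maxFace hb hπ (T := insert i (Finset.univ.filter (c · < 0)))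
    (fun j hj => by simp [hj]) (fun j hj => by
      simp only [Finset.mem_insert, Finset.mem_filter, Finset.mem_univ, true_and] at hj
      rcases hj with rfl | hj
      · exact not_lt.1 hi'
      · exact hj.le))
  have h4 : ∑ j ∈ S, vertex b π (insert i (Finset.univ.filter (c · < 0))) j <
      ∑ j ∈ S, (bound b (π j) : ℝ) := by
    refine Finset.sum_lt_sum (fun j _ => vertex_le hb _ _ _) ⟨i, hiS, ?_⟩
    rw [vertex, if_pos (Finset.mem_insert_self _ _)]
    exact_mod_cast h2
  have h5 := sum_bound_le_topSum hb (S.map π.toEmbedding)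
  rw [← sum_bound_perm, Finset.card_map] at h5
  rw [h3, ← Nat.cast_sum, Nat.cast_lt] at h4
  omega

/-- If `c i ≤ c j`, some vertex of the face ranks `j` above `i`; a set containing `i` but not `j`
then misses a larger bound and cannot be tight. -/
theorem lt_iff_exists_tight (hb : ∀ i, 0 < b i) {c : Fin n → ℝ} {i j : Fin n} (hi : 0 < c i) :
    c j < c i ↔ ∃ S : Finset (Fin n), i ∈ S ∧ j ∉ S ∧
      ∀ x ∈ maxFace (parkingPolytope b) c, ∑ j ∈ S, x j = topSum b S.card := by
  refine ⟨fun hj => ⟨Finset.univ.filter (c i ≤ c ·), by simp, by simpa using hj,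
    fun x hx => ((mem_maxFace_iff hb).1 hx).2.2 i hi⟩, ?_⟩
  rintro ⟨S, hiS, hjS, hS⟩
  by_contra hij
  obtain ⟨π, hπ, h2⟩ := exists_compatible_lt (show i ≠ j by rintro rfl; exact hjS hiS)
    (not_lt.1 hij)
  have h3 := hS _ (vertex_mem_maxFace hb hπ (T := Finset.univ.filter (c · < 0))
    (fun i hi => by simpa using hi) (fun i hi => by
      simp only [Finset.mem_filter, Finset.mem_univ, true_and] at hi
      exact hi.le))
  have h4 : ∑ j ∈ S, vertex b π (Finset.univ.filter (c · < 0)) j ≤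
      ∑ j ∈ S, (bound b (π j) : ℝ) :=
    Finset.sum_le_sum fun j _ => vertex_le hb _ _ _
  have h5 := sum_bound_lt_topSum hb (S := S.map π.toEmbedding) (i := π i) (j := π j)
    (by simpa using hiS) (by simpa using hjS) h2
  rw [← sum_bound_perm, Finset.card_map] at h5
  rw [h3, ← Nat.cast_sum, Nat.cast_le] at h4
  omega

theorem isFree_of_two_le (hn : 0 < n) (hb : ∀ i, 0 < b i) (h2 : 2 ≤ b ⟨0, hn⟩) (c : Fin n → ℝ) :
    IsFree b c := by
  intro i _
  obtain ⟨π, hπ⟩ := exists_compatible c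
  refine ⟨π, hπ, ?_⟩
  rw [← bound_zero (b := b) hn] at h2
  exact h2.trans ((bound_strictMono hb).monotone (Fin.le_def.2 (Nat.zero_le _)))

theorem isFree_of_exists_le (hb : ∀ i, 0 < b i) {c : Fin n → ℝ}
    (h : ∀ i, 0 ≤ c i → ∃ j, j ≠ i ∧ c j ≤ c i) : IsFree b c := by
  intro i hi
  obtain ⟨j, hji, hj⟩ := h i hi
  obtain ⟨π, hπ, h1⟩ := exists_compatible_lt hji hj
  refine ⟨π, hπ, ?_⟩
  have h2 := bound_strictMono hb h1
  have h3 := bound_pos hb (π j)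
  omega

/-- The functional attached to a pair. -/
noncomputable def pairFun (p : (Fin n → ℕ) × Finset (Fin n)) : Fin n → ℝ :=
  fun i => if i ∈ p.2 then -1 else p.1 i

theorem pairFun_neg_iff (p : (Fin n → ℕ) × Finset (Fin n)) (i : Fin n) :
    pairFun p i < 0 ↔ i ∈ p.2 := by
  unfold pairFun
  split_ifs with h <;> simp [h]

theorem pairFun_pos_iff {p : (Fin n → ℕ) × Finset (Fin n)} (hp : p ∈ signedPacked n) (i : Fin n) :
    0 < pairFun p i ↔ 0 < p.1 i := by
  unfold pairFun
  split_ifs with h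
  · simp [(mem_signedPacked.1 hp).2 i h]
  · simp

theorem pairFun_le_iff {p : (Fin n → ℕ) × Finset (Fin n)} (hp : p ∈ signedPacked n) {i : Fin n}
    (j : Fin n) (hi : 0 < p.1 i) : pairFun p i ≤ pairFun p j ↔ p.1 i ≤ p.1 j := by
  have h1 : i ∉ p.2 := fun h => hi.ne' ((mem_signedPacked.1 hp).2 i h)
  unfold pairFun
  rw [if_neg h1]
  split_ifs with h
  · have h2 := (mem_signedPacked.1 hp).2 j h
    refine ⟨fun h3 => ?_, fun h3 => by omega⟩
    have : (0 : ℝ) < p.1 i := by exact_mod_cast hi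
    linarith
  · exact Nat.cast_le

/-- A packed function is the smallest one with its support and its order, since its values have no
gaps. Used in both directions to show that two packed functions agree. -/
theorem le_of_packed {f g : Fin n → ℕ} (hf : IsPacked f) (hs : ∀ i, 0 < f i → 0 < g i)
    (h : ∀ i j, 0 < f i → 0 < f j → f j < f i → g j < g i) (i : Fin n) : f i ≤ g i := by
  induction hv : f i generalizing i with
  | zero => exact Nat.zero_le _
  | succ v ih =>
    have hi : 0 < f i := by omega
    rcases Nat.eq_zero_or_pos v with rfl | hv0
    · exact hs i hi
    · obtain ⟨j, hj⟩ := hf i v hv0 (by omega)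
      have h1 := ih j hj
      have h2 := h i j hi (by omega) (by omega)
      omega

theorem pair_ext {p q : (Fin n → ℕ) × Finset (Fin n)} (hb : ∀ i, 0 < b i)
    (hp : p ∈ signedPacked n) (hq : q ∈ signedPacked n)
    (hpf : IsFree b (pairFun p)) (hqf : IsFree b (pairFun q))
    (h : maxFace (parkingPolytope b) (pairFun p) = maxFace (parkingPolytope b) (pairFun q)) :
    p = q := by
  have hneg : ∀ i, i ∈ p.2 ↔ i ∈ q.2 := by
    intro i
    rw [← pairFun_neg_iff, ← pairFun_neg_iff, hpf.neg_iff hb, hqf.neg_iff hb, h]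
  have hpos : ∀ i, 0 < p.1 i ↔ 0 < q.1 i := by
    intro i
    by_cases hi : i ∈ p.2
    · rw [(mem_signedPacked.1 hp).2 i hi, (mem_signedPacked.1 hq).2 i ((hneg i).1 hi)]
    · have hi' : i ∉ q.2 := fun h' => hi ((hneg i).2 h')
      rw [← pairFun_neg_iff, not_lt] at hi hi'
      rw [← pairFun_pos_iff hp, ← pairFun_pos_iff hq, hpf.pos_iff hb hi, hqf.pos_iff hb hi', h]
  have hlt : ∀ i j, 0 < p.1 i → (p.1 j < p.1 i ↔ q.1 j < q.1 i) := by
    intro i j hi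
    have hi' := (hpos i).1 hi
    rw [← not_le, ← pairFun_le_iff hp j hi, not_le,
      lt_iff_exists_tight hb ((pairFun_pos_iff hp i).2 hi), h,
      ← lt_iff_exists_tight hb ((pairFun_pos_iff hq i).2 hi'), ← not_le,
      pairFun_le_iff hq j hi', not_le]
  refine Prod.ext (funext fun i => le_antisymm ?_ ?_) (Finset.ext hneg)
  · exact le_of_packed (mem_signedPacked.1 hp).1 (fun i => (hpos i).1)
      (fun i j hi _ => (hlt i j hi).1) i
  · exact le_of_packed (mem_signedPacked.1 hq).1 (fun i => (hpos i).2)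
      (fun i j hi _ => (hlt i j ((hpos i).2 hi)).2) i

/-- The positive values of `c` up to `c i`. -/
noncomputable def posValues (c : Fin n → ℝ) (i : Fin n) : Finset ℝ :=
  (Finset.univ.image c).filter fun y => 0 < y ∧ y ≤ c i

theorem mem_posValues {c : Fin n → ℝ} {i : Fin n} {y : ℝ} :
    y ∈ posValues c i ↔ (∃ k, c k = y) ∧ 0 < y ∧ y ≤ c i := by
  simp [posValues]

/-- The pair with the same signs and the same order on the positive coordinates as `c`. -/
noncomputable def toPair (c : Fin n → ℝ) : (Fin n → ℕ) × Finset (Fin n) :=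
  (fun i => (posValues c i).card, Finset.univ.filter (c · < 0))

theorem posValues_mono {c : Fin n → ℝ} {i j : Fin n} (h : c i ≤ c j) :
    posValues c i ⊆ posValues c j := fun y hy => by
  rw [mem_posValues] at hy ⊢
  exact ⟨hy.1, hy.2.1, hy.2.2.trans h⟩

theorem toPair_le {c : Fin n → ℝ} {i j : Fin n} (h : c i ≤ c j) :
    (toPair c).1 i ≤ (toPair c).1 j := Finset.card_le_card (posValues_mono h)

theorem toPair_lt {c : Fin n → ℝ} {i j : Fin n} (hj : 0 < c j) (h : c i < c j) :
    (toPair c).1 i < (toPair c).1 j := by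
  refine Finset.card_lt_card ⟨posValues_mono h.le, fun h1 => ?_⟩
  have := (mem_posValues.1 (h1 (mem_posValues.2 ⟨⟨j, rfl⟩, hj, le_rfl⟩))).2.2
  exact absurd h this.not_gt

theorem toPair_pos_iff {c : Fin n → ℝ} {i : Fin n} : 0 < (toPair c).1 i ↔ 0 < c i := by
  refine Finset.card_pos.trans ⟨?_, fun h => ⟨c i, mem_posValues.2 ⟨⟨i, rfl⟩, h, le_rfl⟩⟩⟩
  rintro ⟨y, hy⟩
  rw [mem_posValues] at hy
  exact hy.2.1.trans_le hy.2.2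

theorem exists_toPair_pred {c : Fin n → ℝ} {i : Fin n} {v : ℕ} (hv : 0 < v)
    (hi : (toPair c).1 i = v + 1) : ∃ j, (toPair c).1 j = v := by
  have hci : 0 < c i := toPair_pos_iff.1 (by omega)
  have hmem : c i ∈ posValues c i := mem_posValues.2 ⟨⟨i, rfl⟩, hci, le_rfl⟩
  have hcard : ((posValues c i).erase (c i)).card = v := by
    rw [Finset.card_erase_of_mem hmem]
    exact (congrArg (· - 1) hi)
  -- The next smaller positive value of `c`; a coordinate attaining it has rank `v`.
  obtain ⟨y, hy, hmax⟩ := Finset.exists_max_image ((posValues c i).erase (c i)) id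
    (Finset.card_pos.1 (by omega))
  rw [Finset.mem_erase, mem_posValues] at hy
  obtain ⟨hne, ⟨j, rfl⟩, hy0, hyi⟩ := hy
  refine ⟨j, ?_⟩
  rw [← hcard]
  change (posValues c j).card = _
  congr 1
  ext y
  constructor
  · intro hy
    rw [Finset.mem_erase]
    refine ⟨?_, posValues_mono hyi hy⟩
    rintro rfl
    exact hne (le_antisymm hyi (mem_posValues.1 hy).2.2)
  · intro hy
    have h1 := mem_posValues.1 (Finset.mem_of_mem_erase hy)
    exact mem_posValues.2 ⟨h1.1, h1.2.1, hmax y hy⟩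

theorem toPair_mem (c : Fin n → ℝ) : toPair c ∈ signedPacked n := by
  refine mem_signedPacked.2 ⟨fun i v hv hvi => ?_, fun i hi => ?_⟩
  · obtain ⟨d, hd⟩ := Nat.exists_eq_add_of_le hvi
    clear hvi
    induction d generalizing i with
    | zero => exact ⟨i, hd⟩
    | succ d ih =>
      obtain ⟨j, hj⟩ := exists_toPair_pred (v := v + d) (by omega) hd
      exact ih j hj
  · have hi' : c i < 0 := by simpa [toPair] using hi
    by_contra h
    exact absurd (toPair_pos_iff.1 (Nat.pos_of_ne_zero h)) hi'.not_gt

theorem maxFace_toPair (hb : ∀ i, 0 < b i) (c : Fin n → ℝ) :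
    maxFace (parkingPolytope b) (pairFun (toPair c)) = maxFace (parkingPolytope b) c := by
  refine (maxFace_congr hb (fun i => ?_) (fun i => ?_) fun i j hi => ?_).symm
  · rw [pairFun_neg_iff]
    simp [toPair]
  · rw [pairFun_pos_iff (toPair_mem c), toPair_pos_iff]
  · rw [pairFun_le_iff (toPair_mem c) j (toPair_pos_iff.2 hi)]
    refine ⟨toPair_le, fun h => ?_⟩
    by_contra h'
    exact absurd (toPair_lt hi (not_le.1 h')) h.not_gt

theorem tight_erase_min {c x : Fin n → ℝ} {i : Fin n} (hi : 0 ≤ c i)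
    (hmin : ∀ j, j ≠ i → c i < c j)
    (hx : ∀ j, j ≠ i → ∑ k with c j ≤ c k, x k = topSum b (Finset.univ.filter (c j ≤ c ·)).card) :
    ∑ k ∈ Finset.univ.erase i, x k = topSum b (n - 1) := by
  have hc : (Finset.univ.erase i).card = n - 1 := by simp
  -- The empty case is `n = 1`, where both sides are `0`; otherwise the second smallest value of `c`
  -- has superlevel set `univ.erase i`.
  rcases (Finset.univ.erase i).eq_empty_or_nonempty with h0 | h0
  · rw [← hc, h0]
    simp [topSum_zero]
  · obtain ⟨j, hj, hj'⟩ := Finset.exists_min_image _ c h0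
    have hji := Finset.ne_of_mem_erase hj
    have h1 : Finset.univ.filter (c j ≤ c ·) = Finset.univ.erase i := by
      ext k
      simp only [Finset.mem_filter, Finset.mem_univ, true_and, Finset.mem_erase, and_true]
      refine ⟨?_, fun hk => hj' k (by simpa using hk)⟩
      rintro h rfl
      exact absurd (hmin j hji) h.not_gt
    have h2 := hx j hji
    rwa [h1, hc] at h2

/-- The other coordinates already sum to `topSum b (n - 1)`, and the total is at most `topSum b (n -
1) + 1` because `b₁ = 1`. So `x i = 1` holds automatically, and it is equivalent to tightness of the
total. -/
theorem maxFace_update (hn : 0 < n) (hb : ∀ i, 0 < b i) (hb1 : b ⟨0, hn⟩ = 1) {c : Fin n → ℝ}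
    {i : Fin n} (hi : 0 ≤ c i) (hmin : ∀ j, j ≠ i → c i < c j) :
    maxFace (parkingPolytope b) (Function.update c i (-1)) = maxFace (parkingPolytope b) c := by
  have hlev : ∀ j, j ≠ i → Finset.univ.filter
      (Function.update c i (-1) j ≤ Function.update c i (-1) ·) =
      Finset.univ.filter (c j ≤ c ·) := by
    intro j hj
    ext k
    simp only [Finset.mem_filter, Finset.mem_univ, true_and, Function.update_of_ne hj]
    by_cases hk : k = i
    · subst hk
      have := hmin j hj
      rw [Function.update_self]
      exact ⟨fun h => by linarith, fun h => by linarith⟩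
    · rw [Function.update_of_ne hk]
  have htop := topSum_eq_add (b := b) hn
  rw [hb1] at htop
  have huniv : Finset.univ.filter (c i ≤ c ·) = Finset.univ := by
    refine Finset.filter_true_of_mem fun j _ => ?_
    by_cases hj : j = i
    · rw [hj]
    · exact (hmin j hj).le
  ext x
  rw [mem_maxFace_iff hb, mem_maxFace_iff hb]
  refine and_congr_right fun hx => ?_
  have hsplit := Finset.sum_erase_add Finset.univ x (Finset.mem_univ i)
  constructor
  · rintro ⟨h1, h2⟩
    have h3 : ∀ j, j ≠ i → ∑ k with c j ≤ c k, x k =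
        topSum b (Finset.univ.filter (c j ≤ c ·)).card := by
      intro j hj
      have := h2 j (by rw [Function.update_of_ne hj]; exact hi.trans_lt (hmin j hj))
      rwa [hlev j hj] at this
    have h4 := tight_erase_min hi hmin h3
    have h5 := h1 i (by simp)
    refine ⟨fun j hj => ?_, fun j _ => ?_⟩
    · by_cases hji : j = i
      · rw [hji, h5]
      · linarith [hmin j hji]
    · by_cases hji : j = i
      · rw [hji, huniv, Finset.card_univ, Fintype.card_fin, htop, ← hsplit, h4, h5]
        push_cast
        ring
      · exact h3 j hji
  · rintro ⟨h1, h2⟩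
    have h3 : ∀ j, j ≠ i → ∑ k with c j ≤ c k, x k =
        topSum b (Finset.univ.filter (c j ≤ c ·)).card :=
      fun j hj => h2 j (hi.trans_lt (hmin j hj))
    have h4 := tight_erase_min hi hmin h3
    refine ⟨fun j hj => ?_, fun j hj => ?_⟩
    · by_cases hji : j = i
      · subst hji
        have h5 := sum_le_topSum hb hx Finset.univ
        rw [Finset.card_univ, Fintype.card_fin, htop, ← hsplit, h4] at h5
        push_cast at h5
        linarith [one_le_of_mem hx j]
      · rw [Function.update_of_ne hji] at hj
        linarith [hmin j hji]
    · have hji : j ≠ i := by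
        rintro rfl
        rw [Function.update_self] at hj
        linarith
      rw [hlev j hji]
      exact h3 j hji

theorem isFree_of_not_isDegenerate (hb : ∀ i, 0 < b i) {p : (Fin n → ℕ) × Finset (Fin n)}
    (hp : ¬ IsDegenerate p) : IsFree b (pairFun p) := by
  refine isFree_of_exists_le hb fun i hi => ?_
  have hi' : i ∉ p.2 := fun h => absurd ((pairFun_neg_iff p i).2 h) hi.not_gt
  rcases p.2.eq_empty_or_nonempty with h0 | ⟨j, hj⟩
  · by_contra! h
    refine hp ⟨h0, i, fun j hj => ?_⟩
    have := h j hj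
    simp only [pairFun, h0, Finset.notMem_empty, if_false] at this
    exact_mod_cast this
  · exact ⟨j, fun h => hi' (h ▸ hj), ((pairFun_neg_iff p j).2 hj).le.trans hi⟩

theorem exists_not_isDegenerate (hn : 0 < n) (hb : ∀ i, 0 < b i) (hb1 : b ⟨0, hn⟩ = 1)
    (c : Fin n → ℝ) : ∃ p ∈ signedPacked n, ¬ IsDegenerate p ∧
      maxFace (parkingPolytope b) (pairFun p) = maxFace (parkingPolytope b) c := by
  by_cases h : IsDegenerate (toPair c)
  · obtain ⟨h1, i, hi⟩ := h
    have h2 : 0 ≤ c i := by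
      by_contra h2
      have : i ∈ (toPair c).2 := by simpa [toPair] using h2
      simp [h1] at this
    have h3 : ∀ j, j ≠ i → c i < c j := fun j hj =>
      lt_of_not_ge fun h => absurd (hi j hj) (toPair_le h).not_gt
    -- Moving `i` into `N` makes `N` nonempty, so the new pair is not degenerate.
    refine ⟨toPair (Function.update c i (-1)), toPair_mem _, fun h4 => ?_, ?_⟩
    · have : i ∈ (toPair (Function.update c i (-1))).2 := by simp [toPair]
      rw [h4.1] at this
      simp at this
    · rw [maxFace_toPair hb, maxFace_update hn hb hb1 h2 h3]
  · exact ⟨toPair c, toPair_mem c, h, maxFace_toPair hb c⟩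

end Recovery

/-! ### Direction space of a face and the resulting `h`-polynomial. -/

section Dimension

variable {n : ℕ} {b : Fin n → ℕ}

/-- The coordinates in `p.2` together with the sums over the levels of `p.1`. -/
noncomputable def levelSums (p : (Fin n → ℕ) × Finset (Fin n)) :
    (Fin n → ℝ) →ₗ[ℝ] (p.2 → ℝ) × (Fin (top p.1) → ℝ) where
  toFun w := (fun i => w i, fun v => ∑ i with p.1 i = v.1 + 1, w i)
  map_add' x y := by
    ext <;> simp [Finset.sum_add_distrib]
  map_smul' r x := by
    ext <;> simp [Finset.mul_sum]

theorem levelSums_surjective {p : (Fin n → ℕ) × Finset (Fin n)} (hp : p ∈ signedPacked n) :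
    Function.Surjective (levelSums p) := by
  rintro ⟨a, q⟩
  rw [mem_signedPacked] at hp
  have h1 : ∀ v : Fin (top p.1), ∃ j, p.1 j = v.1 + 1 := fun v =>
    hp.1.exists_eq (Nat.succ_pos _) v.2
  choose r hr using h1
  have hrN : ∀ v, r v ∉ p.2 := fun v h => by
    have := hp.2 _ h
    rw [hr] at this
    omega
  -- Each prescribed level sum is concentrated on one representative `r v` of the level;
  -- representatives lie outside `N`, so the two summands do not interfere.
  refine ⟨fun i => (∑ v, if i = r v then q v else 0) + if h : i ∈ p.2 then a ⟨i, h⟩ else 0, ?_⟩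
  refine Prod.ext (funext fun i => ?_) (funext fun v => ?_)
  · change (∑ v, if i.1 = r v then q v else 0) + (if h : i.1 ∈ p.2 then a ⟨i, h⟩ else 0) = a i
    rw [dif_pos i.2, Finset.sum_eq_zero, zero_add]
    intro v _
    rw [if_neg]
    intro h
    exact hrN v (h ▸ i.2)
  · change ∑ i with p.1 i = v.1 + 1,
      ((∑ v, if i = r v then q v else 0) + if h : i ∈ p.2 then a ⟨i, h⟩ else 0) = q v
    have h2 : ∀ i ∈ Finset.univ.filter (fun i => p.1 i = v.1 + 1),
        ((∑ v, if i = r v then q v else 0) + if h : i ∈ p.2 then a ⟨i, h⟩ else 0) =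
        if i = r v then q v else 0 := by
      intro i hi
      simp only [Finset.mem_filter, Finset.mem_univ, true_and] at hi
      rw [dif_neg fun h => by have := hp.2 i h; omega, add_zero]
      refine Finset.sum_eq_single v (fun v' _ hv' => if_neg ?_) (by simp)
      rintro rfl
      rw [hr] at hi
      exact hv' (Fin.ext (by omega))
    rw [Finset.sum_congr rfl h2, Finset.sum_ite_eq', if_pos]
    simpa using hr v

theorem finrank_ker_levelSums {p : (Fin n → ℕ) × Finset (Fin n)} (hp : p ∈ signedPacked n) :
    Module.finrank ℝ (LinearMap.ker (levelSums p)) = faceDim p := by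
  have h1 := LinearMap.finrank_range_add_finrank_ker (levelSums p)
  rw [LinearMap.range_eq_top.2 (levelSums_surjective hp), finrank_top, Module.finrank_prod] at h1
  simp only [Module.finrank_fintype_fun_eq_card, Fintype.card_coe, Fintype.card_fin] at h1
  unfold faceDim
  omega

theorem sum_superlevel {p : (Fin n → ℕ) × Finset (Fin n)} (hb : ∀ i, 0 < b i)
    (hp : p ∈ signedPacked n) {x : Fin n → ℝ}
    (hx : x ∈ maxFace (parkingPolytope b) (pairFun p)) {v : ℕ} (hv : 0 < v) :
    ∑ j with v ≤ p.1 j, x j = topSum b (Finset.univ.filter (v ≤ p.1 ·)).card := by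
  by_cases hv' : v ≤ top p.1
  · obtain ⟨i, rfl⟩ := (mem_signedPacked.1 hp).1.exists_eq hv hv'
    have h1 := ((mem_maxFace_iff hb).1 hx).2.2 i ((pairFun_pos_iff hp i).2 hv)
    simpa only [pairFun_le_iff hp _ hv] using h1
  · rw [Finset.filter_false_of_mem]
    · simp [topSum_zero]
    · intro j _ h
      exact hv' (h.trans (le_top _ _))

/-- Differences of consecutive superlevel equations fix the sum of `x` over each single level. -/
theorem vectorSpan_le_ker (hb : ∀ i, 0 < b i) {p : (Fin n → ℕ) × Finset (Fin n)}
    (hp : p ∈ signedPacked n) :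
    vectorSpan ℝ (maxFace (parkingPolytope b) (pairFun p)) ≤ LinearMap.ker (levelSums p) := by
  refine Submodule.span_le.2 ?_
  rintro _ ⟨x, hx, y, hy, rfl⟩
  have hlevel : ∀ {z}, z ∈ maxFace (parkingPolytope b) (pairFun p) → ∀ v, 0 < v →
      ∑ j with p.1 j = v, z j = topSum b (Finset.univ.filter (v ≤ p.1 ·)).card -
        topSum b (Finset.univ.filter (v + 1 ≤ p.1 ·)).card := by
    intro z hz v hv
    rw [← sum_superlevel hb hp hz hv, ← sum_superlevel hb hp hz (Nat.succ_pos v), eq_sub_iff_add_eq,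
      ← Finset.sum_union]
    · refine Finset.sum_congr ?_ fun _ _ => rfl
      ext j
      simp only [Finset.mem_union, Finset.mem_filter, Finset.mem_univ, true_and]
      omega
    · refine Finset.disjoint_left.2 fun j hj hj' => ?_
      simp only [Finset.mem_filter, Finset.mem_univ, true_and] at hj hj'
      omega
  have h1 : ∀ {z}, z ∈ maxFace (parkingPolytope b) (pairFun p) → ∀ i ∈ p.2, z i = 1 :=
    fun hz i hi => ((mem_maxFace_iff hb).1 hz).2.1 i ((pairFun_neg_iff p i).2 hi)
  change levelSums p (x - y) = 0
  rw [map_sub, sub_eq_zero]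
  refine Prod.ext (funext fun i => ?_) (funext fun v => ?_)
  · exact (h1 hx i i.2).trans (h1 hy i i.2).symm
  · exact (hlevel hx _ (Nat.succ_pos _)).trans (hlevel hy _ (Nat.succ_pos _)).symm

/-- Two vertices of the face differ only in whether `i` belongs to `T`; freeness makes the
difference `bound b (π i) - 1` nonzero. -/
theorem single_mem_vectorSpan (hb : ∀ i, 0 < b i) {c : Fin n → ℝ} (hc : IsFree b c) {i : Fin n}
    (hi : c i = 0) :
    (Pi.single i 1 : Fin n → ℝ) ∈ vectorSpan ℝ (maxFace (parkingPolytope b) c) := by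
  obtain ⟨π, hπ, h2⟩ := hc i hi.ge
  set T := Finset.univ.filter (c · < 0) with hT
  have hiT : i ∉ T := by simp [hT, hi]
  have h3 := vsub_mem_vectorSpan ℝ
    (vertex_mem_maxFace hb hπ (T := T) (fun j hj => by simpa [hT] using hj) (fun j hj => by
      simp only [hT, Finset.mem_filter, Finset.mem_univ, true_and] at hj
      exact hj.le))
    (vertex_mem_maxFace hb hπ (T := insert i T) (fun j hj => by simp [hT, hj]) (fun j hj => by
      simp only [hT, Finset.mem_insert, Finset.mem_filter, Finset.mem_univ, true_and] at hj
      rcases hj with rfl | hj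
      · exact hi.le
      · exact hj.le))
  have h4 : vertex b π T -ᵥ vertex b π (insert i T) =
      ((bound b (π i) : ℝ) - 1) • (Pi.single i 1 : Fin n → ℝ) := by
    funext j
    by_cases hj : j = i
    · subst hj
      simp [vertex, hiT]
    · simp [vertex, hj]
  rw [h4] at h3
  have h5 : (2 : ℝ) ≤ bound b (π i) := by exact_mod_cast h2
  exact (Submodule.smul_mem_iff _ (by linarith)).1 h3

/-- Swapping `i` and `j` inside their level keeps `π` compatible, and strict monotonicity of the
bounds makes the two vertices differ. -/
theorem single_sub_single_mem_vectorSpan (hb : ∀ i, 0 < b i) {c : Fin n → ℝ} {i j : Fin n}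
    (hi : 0 < c i) (hij : c i = c j) :
    (Pi.single i 1 - Pi.single j 1 : Fin n → ℝ) ∈
      vectorSpan ℝ (maxFace (parkingPolytope b) c) := by
  rcases eq_or_ne i j with rfl | hne
  · simp
  obtain ⟨π, hπ⟩ := exists_compatible c
  have hswap : ∀ k, c (Equiv.swap i j k) = c k := by
    intro k
    rw [Equiv.swap_apply_def]
    split_ifs with h1 h2
    · rw [h1, hij]
    · rw [h2, hij]
    · rfl
  have hπ' : Compatible c ((Equiv.swap i j).trans π) := by
    intro k l hkl
    exact hπ _ _ (by rwa [hswap, hswap])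
  set T := Finset.univ.filter (c · < 0) with hT
  have hT1 : ∀ k, c k < 0 → k ∈ T := fun k hk => by simpa [hT] using hk
  have hT2 : ∀ k ∈ T, c k ≤ 0 := fun k hk => by
    simp only [hT, Finset.mem_filter, Finset.mem_univ, true_and] at hk
    exact hk.le
  have h3 := vsub_mem_vectorSpan ℝ (vertex_mem_maxFace hb hπ hT1 hT2)
    (vertex_mem_maxFace hb hπ' hT1 hT2)
  have hiT : i ∉ T := fun h => (hT2 i h).not_gt hi
  have hjT : j ∉ T := fun h => (hT2 j h).not_gt (hij ▸ hi)
  have h4 : vertex b π T -ᵥ vertex b ((Equiv.swap i j).trans π) T =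
      ((bound b (π i) : ℝ) - bound b (π j)) • (Pi.single i 1 - Pi.single j 1 : Fin n → ℝ) := by
    funext k
    by_cases hki : k = i
    · subst hki
      simp [vertex, hiT, hne]
    · by_cases hkj : k = j
      · subst hkj
        simp [vertex, hjT, hne.symm]
      · simp [vertex, hki, hkj, Equiv.swap_apply_of_ne_of_ne hki hkj]
  rw [h4] at h3
  refine (Submodule.smul_mem_iff _ fun h => ?_).1 h3
  have h5 : bound b (π i) = bound b (π j) := by exact_mod_cast sub_eq_zero.1 h
  exact hne (π.injective ((bound_strictMono hb).injective h5))

theorem ker_le_vectorSpan (hb : ∀ i, 0 < b i) {p : (Fin n → ℕ) × Finset (Fin n)}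
    (hp : p ∈ signedPacked n) (hf : IsFree b (pairFun p)) :
    LinearMap.ker (levelSums p) ≤ vectorSpan ℝ (maxFace (parkingPolytope b) (pairFun p)) := by
  intro w hw
  have hw1 : ∀ i ∈ p.2, w i = 0 := fun i hi =>
    congrFun (congrArg Prod.fst (LinearMap.mem_ker.1 hw)) ⟨i, hi⟩
  have hw2 : ∀ v, 0 < v → ∑ i with p.1 i = v, w i = 0 := by
    intro v hv
    by_cases hv' : v ≤ top p.1
    · have := congrFun (congrArg Prod.snd (LinearMap.mem_ker.1 hw)) ⟨v - 1, by omega⟩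
      change ∑ i with p.1 i = v - 1 + 1, w i = 0 at this
      rwa [Nat.sub_add_cancel hv] at this
    · rw [Finset.filter_false_of_mem, Finset.sum_empty]
      intro i _ h
      exact hv' (h ▸ le_top p.1 i)
  obtain ⟨ρ, hρ⟩ : ∃ ρ : ℕ → Fin n → ℝ, ∀ i, 0 < p.1 i →
      (Pi.single i 1 - ρ (p.1 i) : Fin n → ℝ) ∈
        vectorSpan ℝ (maxFace (parkingPolytope b) (pairFun p)) := by
    classical
    -- `ρ v` is the basis vector of a chosen representative of level `v`; the default `0` is never
    -- used, as `ρ` is evaluated only at attained values.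
    refine ⟨fun v => if h : ∃ j, p.1 j = v then Pi.single h.choose 1 else 0, fun i hi => ?_⟩
    have h : ∃ j, p.1 j = p.1 i := ⟨i, rfl⟩
    dsimp only
    rw [dif_pos h]
    have h1 := h.choose_spec
    refine single_sub_single_mem_vectorSpan hb ((pairFun_pos_iff hp i).2 hi) (le_antisymm ?_ ?_)
    · exact (pairFun_le_iff hp _ hi).2 h1.ge
    · exact (pairFun_le_iff hp _ (hi.trans_eq h1.symm)).2 h1.le
  have hzero : ∑ i with 0 < p.1 i, w i • ρ (p.1 i) = 0 := by
    rw [← Finset.sum_fiberwise_of_maps_to (t := Finset.Icc 1 (top p.1)) (g := p.1)]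
    · refine Finset.sum_eq_zero fun v hv => ?_
      have hv1 := (Finset.mem_Icc.1 hv).1
      have h1 : (Finset.univ.filter (0 < p.1 ·)).filter (fun i => p.1 i = v) =
          Finset.univ.filter (p.1 · = v) := by
        ext i
        simp only [Finset.mem_filter, Finset.mem_univ, true_and]
        omega
      rw [h1, Finset.sum_congr rfl (g := fun i => w i • ρ v), ← Finset.sum_smul, hw2 v hv1,
        zero_smul]
      intro i hi
      rw [(Finset.mem_filter.1 hi).2]
    · intro i hi
      exact Finset.mem_Icc.2 ⟨(Finset.mem_filter.1 hi).2, le_top p.1 i⟩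
  -- Subtracting the representatives costs nothing because `w` sums to zero on each positive level.
  have hdecomp : w = ∑ i, w i • (Pi.single i 1 - if 0 < p.1 i then ρ (p.1 i) else 0) := by
    simp_rw [smul_sub]
    rw [Finset.sum_sub_distrib]
    simp_rw [smul_ite, smul_zero]
    rw [← Finset.sum_filter, hzero, sub_zero]
    conv_lhs => rw [← Finset.univ_sum_single w]
    refine Finset.sum_congr rfl fun i _ => ?_
    rw [← Pi.single_smul, smul_eq_mul, mul_one]
  rw [hdecomp]
  refine Submodule.sum_mem _ fun i _ => ?_
  by_cases hi : 0 < p.1 i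
  · rw [if_pos hi]
    exact Submodule.smul_mem _ _ (hρ i hi)
  · rw [if_neg hi, sub_zero]
    by_cases hiN : i ∈ p.2
    · rw [hw1 i hiN, zero_smul]
      exact Submodule.zero_mem _
    · refine Submodule.smul_mem _ _ (single_mem_vectorSpan hb hf ?_)
      rw [pairFun, if_neg hiN]
      have : p.1 i = 0 := by omega
      rw [this, Nat.cast_zero]

theorem affineDim_maxFace (hb : ∀ i, 0 < b i) {p : (Fin n → ℕ) × Finset (Fin n)}
    (hp : p ∈ signedPacked n) (hf : IsFree b (pairFun p)) :
    affineDim (maxFace (parkingPolytope b) (pairFun p)) = faceDim p := by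
  rw [affineDim, le_antisymm (vectorSpan_le_ker hb hp) (ker_le_vectorSpan hb hp hf),
    finrank_ker_levelSums hp]

/-- Freeness makes the map from `D` to faces injective with known dimensions, and `hsurj` makes it
surjective. The set `D` is a parameter so that both cases for `b₁` are served. -/
theorem hPolynomial_eq_sum (hb : ∀ i, 0 < b i) {D : Finset ((Fin n → ℕ) × Finset (Fin n))}
    (hD : ∀ p ∈ D, p ∈ signedPacked n ∧ IsFree b (pairFun p))
    (hsurj : ∀ c : Fin n → ℝ, ∃ p ∈ D,
      maxFace (parkingPolytope b) (pairFun p) = maxFace (parkingPolytope b) c) :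
    hPolynomial (parkingPolytope b) = ∑ p ∈ D, (X - 1 : ℤ[X]) ^ faceDim p := by
  have hfaces : ∀ i, facesOfDim (parkingPolytope b) i =
      (fun p => maxFace (parkingPolytope b) (pairFun p)) '' (D.filter (faceDim · = i) : Set _) := by
    intro i
    ext F
    simp only [facesOfDim, Set.mem_ofPred_eq, ← and_assoc, isExposed_and_nonempty_iff hb,
      Set.mem_image, Finset.mem_coe, Finset.mem_filter]
    constructor
    · rintro ⟨⟨c, rfl⟩, h⟩
      obtain ⟨p, hp, hpc⟩ := hsurj c
      rw [← hpc, affineDim_maxFace hb (hD p hp).1 (hD p hp).2] at h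
      exact ⟨p, ⟨hp, h⟩, hpc⟩
    · rintro ⟨p, ⟨hp, h⟩, rfl⟩
      exact ⟨⟨_, rfl⟩, by rw [affineDim_maxFace hb (hD p hp).1 (hD p hp).2, h]⟩
  have hcard : ∀ i, (facesOfDim (parkingPolytope b) i).ncard = (D.filter (faceDim · = i)).card := by
    intro i
    rw [hfaces, Set.InjOn.ncard_image, Set.ncard_coe_finset]
    intro p hp q hq h
    have hp' := hD p (Finset.mem_of_mem_filter p hp)
    have hq' := hD q (Finset.mem_of_mem_filter q hq)
    exact pair_ext hb hp'.1 hq'.1 hp'.2 hq'.2 h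
  have hle : ∀ p ∈ D, faceDim p ∈ Finset.range (affineDim (parkingPolytope b) + 1) := by
    intro p hp
    rw [Finset.mem_range, Nat.lt_succ_iff, ← affineDim_maxFace hb (hD p hp).1 (hD p hp).2]
    exact Submodule.finrank_mono (vectorSpan_mono ℝ fun x hx => hx.1)
  have hfpoly : fPolynomial (parkingPolytope b) = ∑ p ∈ D, X ^ faceDim p := by
    rw [fPolynomial, ← Finset.sum_fiberwise_of_maps_to hle]
    refine Finset.sum_congr rfl fun i _ => ?_
    rw [hcard, Finset.sum_congr rfl (g := fun _ => (X : ℤ[X]) ^ i), Finset.sum_const, nsmul_eq_mul]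
    · simp
    · intro p hp
      rw [(Finset.mem_filter.1 hp).2]
  rw [hPolynomial, hfpoly, ← Polynomial.coe_compRingHom_apply, map_sum]
  simp

end Dimension

end ParkingPolytope

open ParkingPolytope

theorem mainTheorem5 (n : ℕ) (hn : 0 < n) (b : Fin n → ℕ) (hb : ∀ i, 0 < b i) :
    (b ⟨0, hn⟩ = 1 →
      hPolynomial (parkingPolytope b) =
        binomialEulerianPoly n - C (n : ℤ) * X * eulerianPoly (n - 1)) ∧
    (2 ≤ b ⟨0, hn⟩ →
      hPolynomial (parkingPolytope b) = binomialEulerianPoly n) := by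
  classical
  refine ⟨fun h1 => ?_, fun h2 => ?_⟩
  · rw [← sum_signedPacked_not_degenerate_eq]
    refine hPolynomial_eq_sum hb (fun p hp => ?_) fun c => ?_
    · rw [Finset.mem_filter] at hp
      exact ⟨hp.1, isFree_of_not_isDegenerate hb hp.2⟩
    · obtain ⟨p, hp, hp', h⟩ := exists_not_isDegenerate hn hb h1 c
      exact ⟨p, Finset.mem_filter.2 ⟨hp, hp'⟩, h⟩
  · rw [← sum_signedPacked_eq]
    exact hPolynomial_eq_sum hb (fun p hp => ⟨hp, isFree_of_two_le hn hb h2 _⟩)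
      fun c => ⟨toPair c, toPair_mem c, maxFace_toPair hb c⟩
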